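/- Let $n,N\ge 1$ be integers, let $\Omega\subset\mathbb R^n$ be a bounded domain, let $1<p<\infty$, and write $H=L^2(\Omega;\mathbb R^N)$, with inner product $(\cdot,\cdot)$ and norm $\|\cdot\|$. Let $W_0^{1,p}(\Omega;\mathbb R^N)$ be the closure of $C_c^\infty(\Omega;\mathbb R^N)$ in $W^{1,p}(\Omega;\mathbb R^N)$, and let $\mathbf F\colon W_0^{1,p}(\Omega;\mathbb R^N)\to(-\infty,+\infty]$ satisfy $\mathbf F(0)<\infty$. Define $$D(\mathbf F)=\{u\in H\cap W_0^{1,p}(\Omega;\mathbb R^N):\mathbf F(u)<\infty\},$$ $$\mathcal F(u)=\{v\in H:\ \mathbf F(w)\ge\mathbf F(u)+(v,w-u)\ \ \forall\,w\in D(\mathbf F)\}\quad(u\in D(\mathbf F)),\qquad D(\mathcal F)=\{u\in D(\mathbf F):\mathcal F(u)\neq\emptyset\}.$$ **Theorem 1.1.** Assume that $\mathbf F$ is coercive on $W_0^{1,p}(\Omega;\mathbb R^N)$ (that is, $\mathbf F(u)\to+\infty$ as $\|u\|_{W^{1,p}}\to\infty$), lower semicontinuous on $W_0^{1,p}(\Omega;\mathbb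 R^N)$ with respect to its norm, and convex on $H\cap W_0^{1,p}(\Omega;\mathbb R^N)$. Then for every $w\in D(\mathcal F)$ the set $\mathcal F(w)$ is closed and convex in $H$ and $\|\cdot\|$ has a unique minimizer $A^0(w)$ over $\mathcal F(w)$. Moreover, for every $u_0$ in the closure $\overline{D(\mathbf F)}$ of $D(\mathbf F)$ in $H$ there exists a unique function $u\in C^0([0,\infty);H)$ with weak derivative $u'\in L^\infty(\delta,\infty;H)$ for all $\delta>0$ and with $u(t)\in D(\mathcal F)$ for all $t>0$ that solves $$u'(t)\in-\mathcal F(u(t))\ \text{ for a.e. } t>0,\qquad u(0)=u_0.$$ This solution $u$ has the following properties: (i) $\mathbf F(u)\in L^1(0,T)$ for all $T>0$. (ii) $\mathbf F(u)\colon(0,\infty)\to\mathbb R$ is nonincreasing. (iii) $\|u'\|_{L^\infty(\delta,\infty;H)}\le\|A^0(u(\delta))\|$ for all $\delta>0$. (iv) $-u'(t)=A^0(u(t))$ for a.e. $t>0$. (v) If $u_0\in D(\mathbf F)$, then $u'\in L^2(0,T;H)$ and $\mathbf F(u)\in W^{1,1}(0,T)$ for all $T>0$. (vi) If $u_0\in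 D(\mathcal F)$, then $u'\in L^\infty(0,\infty;H)$. -/

import Mathlib

open MeasureTheory Set Filter Topology
open scoped ENNReal ContDiff

noncomputable section

namespace GradFlow

/-- `ℝᵏ` with its Euclidean norm. -/
abbrev RR (k : ℕ) := EuclideanSpace ℝ (Fin k)

/-- `φ` is a test function on `U`: smooth with compact support contained in `U`. -/
def IsTest {E F : Type*} [NormedAddCommGroup E] [NormedSpace ℝ E]
    [NormedAddCommGroup F] [NormedSpace ℝ F] (U : Set E) (φ : E → F) : Prop :=
  ContDiff ℝ ∞ φ ∧ HasCompactSupport φ ∧ tsupport φ ⊆ U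

/-! ### Sobolev spaces -/

section Sobolev

variable {n : ℕ}

/-- `Lᵖ(Ω; ℝᴺ)`. -/
abbrev LpVec (Ω : Set (RR n)) (N : ℕ) (p : ℝ≥0∞) := Lp (RR N) p (volume.restrict Ω)

/-- `Lᵖ(Ω; ℝᴺˣⁿ)`, a matrix being identified with the linear map `ℝⁿ → ℝᴺ` it represents. -/
abbrev LpMat (Ω : Set (RR n)) (N : ℕ) (p : ℝ≥0∞) :=
  Lp (RR n →L[ℝ] RR N) p (volume.restrict Ω)

/-- `g = Du` on `Ω` in the sense of weak derivatives:
`∫_Ω (∂_e φ) u = - ∫_Ω φ (Du e)` for all scalar test functions `φ` on `Ω` and directions `e`. -/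
def IsWeakGradient (Ω : Set (RR n)) {N : ℕ} (u : RR n → RR N)
    (g : RR n → (RR n →L[ℝ] RR N)) : Prop :=
  ∀ φ : RR n → ℝ, IsTest Ω φ → ∀ e : RR n,
    ∫ x in Ω, (fderiv ℝ φ x e) • u x = - ∫ x in Ω, φ x • g x e

/-- `W^{1,p}(Ω; ℝᴺ)`: a Sobolev function `u` is recorded as the pair `(u, Du)`. The norm is
`max (‖u‖_{Lᵖ}, ‖Du‖_{Lᵖ})`, which is equivalent to every usual norm of `W^{1,p}`. -/
def W1p (Ω : Set (RR n)) (N : ℕ) (p : ℝ≥0∞) [hp : Fact (1 ≤ p)] :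
    Submodule ℝ (LpVec Ω N p × LpMat Ω N p) where
  carrier := {w | IsWeakGradient Ω w.1 w.2}
  zero_mem' := by
    intro φ _ e
    have h1 : (fun x => (fderiv ℝ φ x e) • ((0 : LpVec Ω N p) : RR n → RR N) x)
        =ᵐ[volume.restrict Ω] fun _ => 0 := by
      filter_upwards [Lp.coeFn_zero (RR N) p (volume.restrict Ω)] with x hx
      rw [hx]
      simp
    have h2 : (fun x => φ x • ((0 : LpMat Ω N p) : RR n → (RR n →L[ℝ] RR N)) x e)
        =ᵐ[volume.restrict Ω] fun _ => 0 := by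
      filter_upwards [Lp.coeFn_zero (RR n →L[ℝ] RR N) p (volume.restrict Ω)] with x hx
      rw [hx]
      simp
    simp only [Prod.fst_zero, Prod.snd_zero]
    rw [integral_congr_ae h1, integral_congr_ae h2]
    simp
  add_mem' := by
    intro a b ha hb φ hφ e
    have hd : Continuous fun x => fderiv ℝ φ x e :=
      (hφ.1.continuous_fderiv (by simp)).clm_apply continuous_const
    have hdc : HasCompactSupport fun x => fderiv ℝ φ x e := hφ.2.1.fderiv_apply (𝕜 := ℝ) e
    have i1 : ∀ w : LpVec Ω N p,
        Integrable (fun x => (fderiv ℝ φ x e) • w x) (volume.restrict Ω) := fun w =>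
      ((Lp.memLp w).locallyIntegrable hp.out).integrable_smul_left_of_hasCompactSupport hd hdc
    have i2 : ∀ w : LpMat Ω N p,
        Integrable (fun x => φ x • w x e) (volume.restrict Ω) := fun w => by
      have := (((Lp.memLp w).locallyIntegrable hp.out).integrable_smul_left_of_hasCompactSupport
        hφ.1.continuous hφ.2.1).apply_continuousLinearMap e
      simpa using this
    have h1 : (fun x => (fderiv ℝ φ x e) • ((a + b).1 : RR n → RR N) x)
        =ᵐ[volume.restrict Ω]
          fun x => (fderiv ℝ φ x e) • a.1 x + (fderiv ℝ φ x e) • b.1 x := by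
      filter_upwards [Lp.coeFn_add a.1 b.1] with x hx
      rw [Prod.fst_add, hx, Pi.add_apply, smul_add]
    have h2 : (fun x => φ x • ((a + b).2 : RR n → (RR n →L[ℝ] RR N)) x e)
        =ᵐ[volume.restrict Ω] fun x => φ x • a.2 x e + φ x • b.2 x e := by
      filter_upwards [Lp.coeFn_add a.2 b.2] with x hx
      rw [Prod.snd_add, hx, Pi.add_apply, add_apply, smul_add]
    rw [integral_congr_ae h1, integral_congr_ae h2, integral_add (i1 _) (i1 _),
      integral_add (i2 _) (i2 _), ha φ hφ e, hb φ hφ e, neg_add]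
  smul_mem' := by
    intro c a ha φ hφ e
    have h1 : (fun x => (fderiv ℝ φ x e) • ((c • a).1 : RR n → RR N) x)
        =ᵐ[volume.restrict Ω] fun x => c • ((fderiv ℝ φ x e) • a.1 x) := by
      filter_upwards [Lp.coeFn_smul c a.1] with x hx
      rw [Prod.smul_fst, hx, Pi.smul_apply, smul_comm]
    have h2 : (fun x => φ x • ((c • a).2 : RR n → (RR n →L[ℝ] RR N)) x e)
        =ᵐ[volume.restrict Ω] fun x => c • (φ x • a.2 x e) := by
      filter_upwards [Lp.coeFn_smul c a.2] with x hx
      rw [Prod.smul_snd, hx, Pi.smul_apply, smul_apply, smul_comm]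
    rw [integral_congr_ae h1, integral_congr_ae h2, integral_smul, integral_smul, ha φ hφ e,
      smul_neg]

/-- `C_c^∞(Ω; ℝᴺ)` as a linear subspace of `W^{1,p}(Ω; ℝᴺ)`. -/
def testSubmodule (Ω : Set (RR n)) (N : ℕ) (p : ℝ≥0∞) [Fact (1 ≤ p)] :
    Submodule ℝ (W1p Ω N p) where
  carrier := {w | ∃ φ : RR n → RR N, IsTest Ω φ ∧ w.1.1 =ᵐ[volume.restrict Ω] φ}
  zero_mem' := by
    refine ⟨fun _ => 0, ⟨contDiff_const, HasCompactSupport.zero, ?_⟩, Lp.coeFn_zero _ _ _⟩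
    simp
  add_mem' := by
    rintro a b ⟨φ, hφ, ha⟩ ⟨ψ, hψ, hb⟩
    refine ⟨φ + ψ, ⟨hφ.1.add hψ.1, hφ.2.1.add hψ.2.1,
      (tsupport_add φ ψ).trans (union_subset hφ.2.2 hψ.2.2)⟩, ?_⟩
    exact (Lp.coeFn_add a.1.1 b.1.1).trans (ha.add hb)
  smul_mem' := by
    rintro c a ⟨φ, hφ, ha⟩
    refine ⟨fun x => c • φ x, ⟨hφ.1.const_smul c, hφ.2.1.smul_left (f := fun _ => c),
      (closure_mono (Function.support_const_smul_subset c φ)).trans hφ.2.2⟩, ?_⟩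
    filter_upwards [Lp.coeFn_smul c a.1.1, ha] with x h1 h2
    simpa [h2] using h1

/-- `W_0^{1,p}(Ω; ℝᴺ)`: the closure of `C_c^∞(Ω; ℝᴺ)` in `W^{1,p}(Ω; ℝᴺ)`. -/
def W0p (Ω : Set (RR n)) (N : ℕ) (p : ℝ≥0∞) [Fact (1 ≤ p)] : Type :=
  ↥(testSubmodule Ω N p).topologicalClosure

instance (Ω : Set (RR n)) (N : ℕ) (p : ℝ≥0∞) [Fact (1 ≤ p)] : NormedAddCommGroup (W0p Ω N p) :=
  Submodule.normedAddCommGroup (testSubmodule Ω N p).topologicalClosure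

instance (Ω : Set (RR n)) (N : ℕ) (p : ℝ≥0∞) [Fact (1 ≤ p)] : NormedSpace ℝ (W0p Ω N p) :=
  Submodule.normedSpace (testSubmodule Ω N p).topologicalClosure

/-- The function underlying an element of `W_0^{1,p}`, as an element of `Lᵖ`. -/
def W0p.toLp {Ω : Set (RR n)} {N : ℕ} {p : ℝ≥0∞} [Fact (1 ≤ p)] (w : W0p Ω N p) : LpVec Ω N p :=
  w.1.1.1

/-- An element of `W_0^{1,p}` is determined by its underlying function. -/
theorem W0p.toLp_injective {Ω : Set (RR n)} (hΩ : IsOpen Ω) {N : ℕ} {p : ℝ≥0∞}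
    [hp : Fact (1 ≤ p)] : Function.Injective (W0p.toLp : W0p Ω N p → LpVec Ω N p) := by
  intro w₁ w₂ h
  have key : ∀ w : W1p Ω N p, w.1.1 = 0 → w = 0 := by
    intro w hw
    refine Subtype.ext (Prod.ext hw ?_)
    have hg : ∀ e : RR n, ∀ᵐ x ∂(volume.restrict Ω), w.1.2 x e = 0 := by
      intro e
      have hli : LocallyIntegrableOn (fun x => w.1.2 x e) Ω volume := by
        have h1 : LocallyIntegrable (fun x => w.1.2 x e) (volume.restrict Ω) := by
          have h2 : MemLp (fun x => w.1.2 x e) p (volume.restrict Ω) :=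
            (ContinuousLinearMap.apply ℝ (RR N) e).comp_memLp' (Lp.memLp w.1.2)
          exact h2.locallyIntegrable hp.out
        exact locallyIntegrableOn_of_locallyIntegrable_restrict h1
      have := hΩ.ae_eq_zero_of_integral_contDiff_smul_eq_zero (μ := volume) hli (by
        intro φ h1 h2 h3
        have h4 := w.2 φ ⟨h1, h2, h3⟩ e
        have h5 : (fun x => (fderiv ℝ φ x e) • w.1.1 x) =ᵐ[volume.restrict Ω] fun _ => 0 := by
          rw [hw]
          filter_upwards [Lp.coeFn_zero (RR N) p (volume.restrict Ω)] with x hx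
          rw [hx]
          simp
        rw [integral_congr_ae h5, integral_zero, eq_comm, neg_eq_zero] at h4
        rw [← h4]
        refine (setIntegral_eq_integral_of_forall_compl_eq_zero fun x hx => ?_).symm
        have : x ∉ tsupport φ := fun h => hx (h3 h)
        simp [image_eq_zero_of_notMem_tsupport this])
      rw [ae_restrict_iff' hΩ.measurableSet]
      exact this
    refine Lp.ext ?_
    have hall : ∀ᵐ x ∂(volume.restrict Ω), ∀ i : Fin n,
        w.1.2 x (EuclideanSpace.basisFun (Fin n) ℝ i) = 0 := ae_all_iff.2 fun i => hg _
    filter_upwards [hall, Lp.coeFn_zero (RR n →L[ℝ] RR N) p (volume.restrict Ω)] with x h1 h2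
    change w.1.2 x = ((0 : LpMat Ω N p) : RR n → (RR n →L[ℝ] RR N)) x
    rw [h2]
    apply ContinuousLinearMap.coe_injective
    exact (EuclideanSpace.basisFun (Fin n) ℝ).toBasis.ext fun i => by simpa using h1 i
  have h0 : (w₁.1 - w₂.1) = 0 := key _ (by
    change w₁.1.1.1 - w₂.1.1.1 = 0
    exact sub_eq_zero.2 h)
  exact Subtype.ext (sub_eq_zero.1 h0)

end Sobolev

/-! ### Functionals on `W_0^{1,p}` -/

section Functional

variable {n : ℕ} {Ω : Set (RR n)} {N : ℕ} {p : ℝ≥0∞} [Fact (1 ≤ p)]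

/-- The element `w` of `W_0^{1,p}` and the element `u` of `L²` are the same function. -/
def Represents (w : W0p Ω N p) (u : LpVec Ω N 2) : Prop :=
  W0p.toLp w =ᵐ[volume.restrict Ω] u

/-- `F` is coercive: `F(w) → +∞` as `‖w‖_{W^{1,p}} → ∞`. -/
def Coercive (F : W0p Ω N p → EReal) : Prop :=
  Tendsto F (Bornology.cobounded (W0p Ω N p)) (𝓝 ⊤)

/-- `F` is convex on `L² ∩ W_0^{1,p}`. -/
def ConvexOnL2 (F : W0p Ω N p → EReal) : Prop :=
  ∀ v w : W0p Ω N p, MemLp (W0p.toLp v) 2 (volume.restrict Ω) → MemLp (W0p.toLp w) 2 (volume.restrict Ω) →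
    ∀ a b : ℝ, 0 ≤ a → 0 ≤ b → a + b = 1 →
      F (a • v + b • w) ≤ (a : EReal) * F v + (b : EReal) * F w

/-- The value `F(u)` for `u ∈ L²`; it is `+∞` if `u` does not belong to `W_0^{1,p}`.
(The infimum runs over at most one `w`, see `energy_eq`.) -/
def energy (F : W0p Ω N p → EReal) (u : LpVec Ω N 2) : EReal :=
  ⨅ (w : W0p Ω N p) (_ : Represents w u), F w

theorem energy_eq (hΩ : IsOpen Ω) (F : W0p Ω N p → EReal) {u : LpVec Ω N 2} {w : W0p Ω N p}
    (h : Represents w u) : energy F u = F w := by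
  refine le_antisymm (iInf₂_le w h) (le_iInf₂ fun w' h' => ?_)
  have : w' = w := W0p.toLp_injective hΩ (Lp.ext (h'.trans h.symm))
  rw [this]

/-- `D(F) = {u ∈ L² ∩ W_0^{1,p} : F(u) < ∞}`. -/
def dom (F : W0p Ω N p → EReal) : Set (LpVec Ω N 2) :=
  {u | (∃ w : W0p Ω N p, Represents w u) ∧ energy F u < ⊤}

/-- The `L²`-subdifferential set of `F` at `u` (empty if `u ∉ D(F)`). -/
def subdiff (F : W0p Ω N p → EReal) (u : LpVec Ω N 2) : Set (LpVec Ω N 2) :=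
  {v | u ∈ dom F ∧ ∀ w ∈ dom F, energy F u + ((inner ℝ v (w - u) : ℝ) : EReal) ≤ energy F w}

/-- The domain of the `L²`-subdifferential. -/
def subdiffDom (F : W0p Ω N p → EReal) : Set (LpVec Ω N 2) :=
  {u | u ∈ dom F ∧ (subdiff F u).Nonempty}

/-- `a` is the unique minimizer of the `L²`-norm over the subdifferential of `F` at `u`. -/
def IsMinimalSection (F : W0p Ω N p → EReal) (u a : LpVec Ω N 2) : Prop :=
  a ∈ subdiff F u ∧ ∀ z ∈ subdiff F u, z ≠ a → ‖a‖ < ‖z‖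

open Classical in
/-- `A⁰(u)`, the element of minimal norm of the subdifferential of `F` at `u`
(with the value `0` where there is none). -/
def minimalSection (F : W0p Ω N p → EReal) (u : LpVec Ω N 2) : LpVec Ω N 2 :=
  if h : ∃ a, IsMinimalSection F u a then h.choose else 0

end Functional

/-! ### Functions of time -/

/-- `v` is the weak derivative of the vector-valued function `u` on the open set `J ⊆ ℝ`. -/
def HasWeakDerivOn {E : Type*} [NormedAddCommGroup E] [NormedSpace ℝ E]
    (J : Set ℝ) (u v : ℝ → E) : Prop :=
  LocallyIntegrableOn u J ∧ LocallyIntegrableOn v J ∧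
    ∀ φ : ℝ → ℝ, IsTest J φ → ∫ t in J, deriv φ t • u t = - ∫ t in J, φ t • v t

/-- `f ∈ W^{1,1}(0,T)`. -/
def MemW11 (T : ℝ) (f : ℝ → ℝ) : Prop :=
  IntegrableOn f (Ioo 0 T) ∧ ∃ g : ℝ → ℝ, IntegrableOn g (Ioo 0 T) ∧ HasWeakDerivOn (Ioo 0 T) f g

/-- `u`, with `u' = du`, solves the gradient flow `u' ∈ -∂F(u)` a.e. on `(0,∞)`, `u(0) = u₀`, in
the class `u ∈ C⁰([0,∞);L²)`, `u' ∈ L^∞(δ,∞;L²)` for all `δ > 0`, and `u(t)` lies in the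
domain of the subdifferential for all `t > 0`. Only the values `u(t)` for `t ≥ 0` matter. -/
structure IsFlow {n : ℕ} {Ω : Set (RR n)} {N : ℕ} {p : ℝ≥0∞} [Fact (1 ≤ p)]
    (F : W0p Ω N p → EReal) (u₀ : LpVec Ω N 2) (u du : ℝ → LpVec Ω N 2) : Prop where
  continuousOn : ContinuousOn u (Ici 0)
  weakDeriv : HasWeakDerivOn (Ioi 0) u du
  bound : ∀ δ : ℝ, 0 < δ → MemLp du ⊤ (volume.restrict (Ioi δ))
  mem_dom : ∀ t : ℝ, 0 < t → u t ∈ subdiffDom F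
  inclusion : ∀ᵐ t ∂(volume.restrict (Ioi (0 : ℝ))), - du t ∈ subdiff F (u t)
  initial : u 0 = u₀

end GradFlow

end

/-! Extend the functional by `+∞` to `H = L²`. The flow theory uses only what `ConvexEnergy`
records: a proper convex functional, bounded below, with closed sublevel sets. That these hold is a
weak compactness statement (`convexEnergy`): by coercivity the sublevel sets are bounded and convex
in `W_0^{1,p}`, `1 < p < ∞`. Weak topologies never appear. In a uniformly convex setting nested
nonempty bounded convex sets have a common point of closure, and since only norm closures occur,
lower semicontinuity in norm suffices.

The flow is described by the evolution variational inequality `‖u(t) - w‖² - ‖u(s) - w‖² ≤ 2 (t - s)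
(f(w) - f(u(t)))`, which involves no derivative and survives limits. Implicit Euler schemes satisfy
it on their grid. Schemes with steps `τ` and `τ/2` differ by `O(√τ)`, so the dyadic schemes
converge. The inequality makes solutions contract, which extends existence from `D` to its closure.

For regularity, `-(u(s+h) - u(s))/h` is an approximate subgradient at `u(s)`. Contraction between
`u` and its time shifts makes increments decrease in time. Combined with energy dissipation this
bounds the quotients at each `t > 0`, and a weak cluster point is a subgradient
(`ConvexEnergy.subgrad_nonempty`). The quotients are no longer than any subgradient at `u(s)`, so
they converge strongly to the shortest one (`IsMinSubgrad.tendsto`). Hence at every `t > 0` the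
right derivative exists and equals `-A⁰(u(t))`, and the velocity bounds follow. The integrability
claims come from integrating the subgradient inequality and the identity `d/dt f(u) = -‖u'‖²`.

Uniqueness must cover solutions known only through a weak derivative. Such a solution is a primitive
of its derivative, and monotonicity of the subdifferential makes the distance of two solutions
nonincreasing. -/

namespace GradFlow

/-! ### Nested bounded convex sets as a substitute for weak compactness -/

section WeakCompactness

/-- A decreasing sequence of nonempty convex sets, bounded for a function `J` that is uniformly
convex on them, has a common point of closure. -/
theorem exists_forall_mem_closure_of_uniformlyConvex {X : Type*} [NormedAddCommGroup X]
    [NormedSpace ℝ X] [CompleteSpace X] (J : X → ℝ) (C : ℕ → Set X) (hanti : Antitone C)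
    (hconv : ∀ k, Convex ℝ (C k)) (hne : ∀ k, (C k).Nonempty) {B : ℝ} (hB : ∀ x ∈ C 0, J x ≤ B)
    (hJ0 : ∀ x ∈ C 0, 0 ≤ J x)
    (hJ : ∀ ε > 0, ∃ δ > 0, ∀ x ∈ C 0, ∀ y ∈ C 0,
      (J x + J y) / 2 - J ((1 / 2 : ℝ) • (x + y)) ≤ δ → dist x y ≤ ε) :
    ∃ x, ∀ k, x ∈ closure (C k) := by
  have hsub : ∀ k, C k ⊆ C 0 := fun k => hanti (Nat.zero_le k)
  set d : ℕ → ℝ := fun k => sInf (J '' C k) with hd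
  have hbdd : ∀ k, BddBelow (J '' C k) := fun k =>
    ⟨0, by rintro _ ⟨x, hx, rfl⟩; exact hJ0 x (hsub k hx)⟩
  have hdle : ∀ k, ∀ x ∈ C k, d k ≤ J x := fun k x hx => csInf_le (hbdd k) ⟨x, hx, rfl⟩
  have hdmono : Monotone d := fun k l hkl =>
    csInf_le_csInf (hbdd k) ((hne l).image J) (image_mono (hanti hkl))
  have hdB : ∀ k, d k ≤ B := fun k => by
    obtain ⟨x, hx⟩ := hne k
    exact (hdle k x hx).trans (hB x (hsub k hx))
  have hlim : Tendsto d atTop (𝓝 (⨆ k, d k)) :=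
    tendsto_atTop_ciSup hdmono ⟨B, by rintro _ ⟨k, rfl⟩; exact hdB k⟩
  have hsup : ∀ k, d k ≤ ⨆ k, d k := fun k => le_ciSup ⟨B, by rintro _ ⟨k, rfl⟩; exact hdB k⟩ k
  have hex : ∀ k, ∃ x ∈ C k, J x < d k + 1 / ((k : ℝ) + 1) := fun k => by
    obtain ⟨_, ⟨x, hx, rfl⟩, h⟩ := exists_lt_of_csInf_lt ((hne k).image J)
      (lt_add_of_pos_right (d k) (by positivity : (0 : ℝ) < 1 / ((k : ℝ) + 1)))
    exact ⟨x, hx, h⟩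
  choose x hxC hxJ using hex
  have hcauchy : CauchySeq x := by
    refine Metric.cauchySeq_iff'.2 fun ε hε => ?_
    obtain ⟨δ, hδ, h⟩ := hJ (ε / 2) (by positivity)
    have h1 : ∀ᶠ k in atTop, (⨆ k, d k) - δ / 2 < d k :=
      hlim.eventually (lt_mem_nhds (by linarith))
    have h2 : ∀ᶠ k : ℕ in atTop, 1 / ((k : ℝ) + 1) < δ / 2 :=
      tendsto_one_div_add_atTop_nhds_zero_nat.eventually (gt_mem_nhds (by positivity))
    obtain ⟨k, hk1, hk2⟩ := (h1.and h2).exists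
    refine ⟨k, fun l hl => lt_of_le_of_lt ?_ (half_lt_self hε)⟩
    refine h _ (hsub _ (hxC l)) _ (hsub _ (hxC k)) ?_
    -- The midpoint stays in `C k`, so `J` is at least `d k` there. The two ends are nearly minimal,
    -- so the midpoint defect is at most `(sup d - d k) / 2 + 1 / (k + 1) ≤ δ`.
    have hmid : (1 / 2 : ℝ) • (x l + x k) ∈ C k := by
      rw [smul_add]
      exact hconv k (hanti hl (hxC l)) (hxC k) (by norm_num) (by norm_num) (by norm_num)
    have := hdle k _ hmid
    have h3 := hxJ l
    have h4 := hxJ k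
    have h5 := hsup l
    have h6 : 1 / ((l : ℝ) + 1) ≤ 1 / ((k : ℝ) + 1) := by
      have : (k : ℝ) ≤ l := by exact_mod_cast hl
      gcongr
    linarith
  obtain ⟨y, hy⟩ := cauchySeq_tendsto_of_complete hcauchy
  refine ⟨y, fun k => mem_closure_of_tendsto hy ?_⟩
  filter_upwards [eventually_ge_atTop k] with l hl using hanti hl (hxC l)

variable {H : Type*} [NormedAddCommGroup H] [InnerProductSpace ℝ H]

/-- In a Hilbert space a decreasing sequence of nonempty bounded convex sets has a common point of
closure. -/
theorem exists_forall_mem_closure_of_convex [CompleteSpace H] (C : ℕ → Set H) (hanti : Antitone C)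
    (hconv : ∀ k, Convex ℝ (C k)) (hne : ∀ k, (C k).Nonempty) {B : ℝ}
    (hB : ∀ x ∈ C 0, ‖x‖ ≤ B) : ∃ x, ∀ k, x ∈ closure (C k) := by
  refine exists_forall_mem_closure_of_uniformlyConvex (fun x => ‖x‖ ^ 2) C hanti hconv hne
    (B := B ^ 2) (fun x hx => ?_) (fun x _ => by positivity) fun ε hε =>
      ⟨ε ^ 2 / 4, by positivity, fun x _ y _ h => ?_⟩
  · have := hB x hx
    gcongr
  · rw [norm_smul, mul_pow] at h
    have h1 := norm_add_sq_real x y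
    have h2 := norm_sub_sq_real x y
    rw [dist_eq_norm]
    refine (sq_le_sq₀ (norm_nonneg _) hε.le).1 ?_
    norm_num at h
    linarith

end WeakCompactness

/-! ### Closed convex functionals on a Hilbert space: subgradients and the implicit Euler step -/

section ConvexEnergy

variable {H : Type*} [NormedAddCommGroup H] [InnerProductSpace ℝ H]

/-- `f` is a proper convex functional with effective domain `D`, bounded below and with closed
sublevel sets. -/
structure ConvexEnergy (D : Set H) (f : H → ℝ) : Prop where
  convexOn : ConvexOn ℝ D f
  nonempty : D.Nonempty
  bddBelow : ∃ m, ∀ u ∈ D, m ≤ f u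
  isClosed : ∀ c, IsClosed {u | u ∈ D ∧ f u ≤ c}

/-- The subdifferential at `u` of the functional `f` with effective domain `D`. -/
def subgrad (D : Set H) (f : H → ℝ) (u : H) : Set H :=
  {v | u ∈ D ∧ ∀ w ∈ D, f u + inner ℝ v (w - u) ≤ f w}

variable {D : Set H} {f : H → ℝ}

theorem ConvexEnergy.mem_of_tendsto (hf : ConvexEnergy D f) {ι : Type*} {l : Filter ι} [l.NeBot]
    {a : ι → H} {x : H} (ha : Tendsto a l (𝓝 x)) {c : ℝ} (h : ∀ᶠ i in l, a i ∈ D ∧ f (a i) ≤ c) :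
    x ∈ D ∧ f x ≤ c :=
  (hf.isClosed c).mem_of_tendsto ha h

/-- Closedness of the sublevel sets, read as lower semicontinuity along points of `D`. -/
theorem ConvexEnergy.eventually_lt (hf : ConvexEnergy D f) {ι : Type*} {l : Filter ι}
    {a : ι → H} {x : H} (ha : Tendsto a l (𝓝 x)) (haD : ∀ᶠ i in l, a i ∈ D) {c : ℝ}
    (hc : c < f x) : ∀ᶠ i in l, c < f (a i) := by
  have h1 : {u | u ∈ D ∧ f u ≤ c}ᶜ ∈ 𝓝 x :=
    (hf.isClosed c).isOpen_compl.mem_nhds fun h => not_le.2 hc h.2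
  filter_upwards [ha h1, haD] with i hi hiD
  by_contra hcon
  exact hi ⟨hiD, not_lt.1 hcon⟩

/-- A bounded sequence of approximate subgradients at `u` has a weak cluster point, and that is a
subgradient. -/
theorem exists_subgrad_of_approx [CompleteSpace H] {u : H} (hu : u ∈ D) {v : ℕ → H} {R : ℝ}
    (hR : ∀ k, ‖v k‖ ≤ R)
    (hv : ∀ w ∈ D, ∀ ε > 0, ∀ᶠ k in atTop, f u + inner ℝ (v k) (w - u) ≤ f w + ε) :
    ∃ x ∈ subgrad D f u, ‖x‖ ≤ R ∧ ∀ S : Set H, IsClosed S → Convex ℝ S → (∀ k, v k ∈ S) →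
      x ∈ S := by
  -- The weak cluster point will be a common point of the closed convex hulls of the tails. Such a
  -- point inherits every closed convex condition that holds along a tail, in particular each
  -- half-space that defines a subgradient.
  have key : ∀ S : Set H, IsClosed S → Convex ℝ S → ∀ k, (∀ j ≥ k, v j ∈ S) →
      closure (convexHull ℝ (v '' Ici k)) ⊆ S := by
    intro S h1 h2 k h3
    refine closure_minimal (convexHull_min ?_ h2) h1
    rintro _ ⟨j, hj, rfl⟩
    exact h3 j hj
  have hball : ∀ k, closure (convexHull ℝ (v '' Ici k)) ⊆ Metric.closedBall 0 R := fun k =>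
    key _ Metric.isClosed_closedBall (convex_closedBall 0 R) k fun j _ => by simpa using hR j
  obtain ⟨x, hx⟩ := exists_forall_mem_closure_of_convex
    (fun k => convexHull ℝ (v '' Ici k)) (fun k l hkl => convexHull_mono
      (image_mono (Ici_subset_Ici.2 hkl))) (fun k => convex_convexHull ℝ _)
    (fun k => ⟨v k, subset_convexHull ℝ _ ⟨k, self_mem_Ici, rfl⟩⟩) (B := R)
    (fun x hx => by simpa using hball 0 (subset_closure hx))
  refine ⟨x, ⟨hu, fun w hw => le_of_forall_pos_le_add fun ε hε => ?_⟩,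
    by simpa using hball 0 (hx 0), fun S h1 h2 h3 => key S h1 h2 0 (fun j _ => h3 j) (hx 0)⟩
  obtain ⟨k, hk⟩ := eventually_atTop.1 (hv w hw ε hε)
  have := key {y | f u + inner ℝ y (w - u) ≤ f w + ε}
    (isClosed_le (by fun_prop) continuous_const) ?_ k hk (hx k)
  · exact this
  · have hlin : IsLinearMap ℝ fun y : H => inner ℝ y (w - u) :=
      ⟨fun a b => inner_add_left _ _ _, fun c a => by simp [inner_smul_left]⟩
    have := convex_halfSpace_le hlin (f w + ε - f u)
    convert this using 2
    ext y
    constructor <;> intro h <;> linarith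

/-- `z` is the shortest subgradient of `f` at `u`. -/
def IsMinSubgrad (D : Set H) (f : H → ℝ) (u z : H) : Prop :=
  z ∈ subgrad D f u ∧ ∀ y ∈ subgrad D f u, y ≠ z → ‖z‖ < ‖y‖

/-- Approximate subgradients that are asymptotically not longer than the shortest subgradient `z`
converge to it strongly. -/
theorem IsMinSubgrad.tendsto [CompleteSpace H] {u z : H} (hz : IsMinSubgrad D f u z)
    {ι : Type*} {l : Filter ι} [l.IsCountablyGenerated] {v : ι → H}
    (hR : ∀ᶠ k in l, ‖v k‖ ≤ ‖z‖)
    (hv : ∀ w ∈ D, ∀ ε > 0, ∀ᶠ k in l, f u + inner ℝ (v k) (w - u) ≤ f w + ε) :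
    Tendsto v l (𝓝 z) := by
  by_contra hcon
  rw [Metric.tendsto_nhds] at hcon
  push Not at hcon
  obtain ⟨ε, hε, hfar⟩ := hcon
  obtain ⟨φ, hφ, hfar⟩ := exists_seq_forall_of_frequently (hfar.and_eventually hR)
  obtain ⟨x, hx, hxR, hxS⟩ := exists_subgrad_of_approx hz.1.1 (v := v ∘ φ) (fun k => (hfar k).2)
    fun w hw ε hε => hφ.eventually (hv w hw ε hε)
  have hxz : x = z := by
    by_contra h
    exact absurd (hz.2 x hx h) (not_lt.2 hxR)
  have hlin : IsLinearMap ℝ fun y : H => inner ℝ y z :=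
    ⟨fun a b => inner_add_left _ _ _, fun c a => by simp [inner_smul_left]⟩
  -- Since `‖v‖ ≤ ‖z‖` and `‖v - z‖ ≥ ε`, expanding the square puts each `v` in this half-space. The
  -- point `z` itself lies outside it, so the cluster point cannot be `z`.
  have := hxS {y | inner ℝ y z ≤ ‖z‖ ^ 2 - ε ^ 2 / 2}
    (isClosed_le (by fun_prop) continuous_const) (convex_halfSpace_le hlin _) fun k => by
      have h1 := (hfar k).1
      rw [dist_eq_norm] at h1
      have h2 := norm_sub_sq_real (v (φ k)) z
      have h3 : ‖v (φ k)‖ ^ 2 ≤ ‖z‖ ^ 2 := by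
        have := (hfar k).2
        gcongr
      have h4 : ε ^ 2 ≤ ‖v (φ k) - z‖ ^ 2 := by gcongr
      simp only [Function.comp, mem_ofPred_eq]
      linarith
  rw [hxz, mem_ofPred_eq, real_inner_self_eq_norm_sq] at this
  nlinarith

theorem isClosed_subgrad (u : H) : IsClosed (subgrad D f u) := by
  have : subgrad D f u = {v | u ∈ D} ∩ ⋂ w ∈ D, {v | f u + inner ℝ v (w - u) ≤ f w} := by
    ext v
    simp [subgrad]
  rw [this]
  exact isClosed_const.inter (isClosed_biInter fun w _ =>
    isClosed_le (by fun_prop) continuous_const)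

theorem convex_subgrad (u : H) : Convex ℝ (subgrad D f u) := by
  intro v hv v' hv' a b ha hb hab
  refine ⟨hv.1, fun w hw => ?_⟩
  have h1 := mul_le_mul_of_nonneg_left (hv.2 w hw) ha
  have h2 := mul_le_mul_of_nonneg_left (hv'.2 w hw) hb
  rw [inner_add_left, real_inner_smul_left, real_inner_smul_left]
  have h3 : b = 1 - a := by linarith
  subst h3
  linarith

/-- A nonempty subdifferential has a unique element of least norm. -/
theorem exists_minimal_subgrad [CompleteSpace H] {u : H} (h : (subgrad D f u).Nonempty) :
    ∃ z, IsMinSubgrad D f u z := by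
  obtain ⟨z, hz, hmin⟩ := exists_norm_eq_iInf_of_complete_convex h
    (isClosed_subgrad u).isComplete (convex_subgrad u) 0
  refine ⟨z, hz, fun y hy hyz => ?_⟩
  have h1 := (norm_eq_iInf_iff_real_inner_le_zero (convex_subgrad u) hz).1 hmin y hy
  have h2 : 0 < ‖y - z‖ ^ 2 := by
    have : 0 < ‖y - z‖ := norm_pos_iff.2 (sub_ne_zero.2 hyz)
    positivity
  have h3 := norm_add_sq_real z (y - z)
  rw [add_sub_cancel] at h3
  rw [zero_sub, inner_neg_left] at h1
  exact lt_of_pow_lt_pow_left₀ 2 (norm_nonneg _) (by linarith)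

/-- The implicit Euler step. -/
theorem ConvexEnergy.exists_prox [CompleteSpace H] (hf : ConvexEnergy D f) {τ : ℝ} (hτ : 0 < τ)
    (u : H) : ∃ U ∈ D, ∀ w ∈ D,
      ‖U - w‖ ^ 2 - ‖u - w‖ ^ 2 + ‖U - u‖ ^ 2 ≤ 2 * τ * (f w - f U) := by
  obtain ⟨m, hm⟩ := hf.bddBelow
  set Φ : H → ℝ := fun w => 2 * τ * f w + ‖w - u‖ ^ 2 with hΦ
  have hbdd : BddBelow (Φ '' D) := ⟨2 * τ * m, by
    rintro _ ⟨w, hw, rfl⟩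
    have := mul_le_mul_of_nonneg_left (hm w hw) (by positivity : 0 ≤ 2 * τ)
    have := sq_nonneg ‖w - u‖
    simp only [hΦ]
    linarith⟩
  set I := sInf (Φ '' D)
  have hI : ∀ w ∈ D, I ≤ Φ w := fun w hw => csInf_le hbdd ⟨w, hw, rfl⟩
  have hΦconv : ConvexOn ℝ D Φ := by
    refine (hf.convexOn.smul (by positivity : 0 ≤ 2 * τ)).add ?_
    refine (ConvexOn.pow ?_ (fun _ _ => norm_nonneg _) 2)
    refine ⟨hf.convexOn.1, fun x _ y _ a b ha hb hab => ?_⟩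
    have : a • x + b • y - u = a • (x - u) + b • (y - u) := by
      have h : u = (a + b) • u := by rw [hab, one_smul]
      conv_lhs => rw [h]
      module
    beta_reduce
    rw [this]
    refine (norm_add_le _ _).trans (le_of_eq ?_)
    rw [norm_smul, norm_smul, Real.norm_of_nonneg ha, Real.norm_of_nonneg hb, smul_eq_mul,
      smul_eq_mul]
  -- The sets of near-minimisers of `Φ` are nested and convex. They are bounded because `f ≥ m` on
  -- `D`; the radius uses `r ≤ 1 + r²` with `r = ‖w - u‖`.
  obtain ⟨U, hU⟩ := exists_forall_mem_closure_of_convex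
    (fun k : ℕ => {w | w ∈ D ∧ Φ w ≤ I + 1 / ((k : ℝ) + 1)})
    (fun k l hkl w hw => ⟨hw.1, hw.2.trans (by
      have : (k : ℝ) ≤ l := by exact_mod_cast hkl
      gcongr)⟩) (fun k => hΦconv.convex_le _) (fun k => by
      obtain ⟨_, ⟨x, hx, rfl⟩, h⟩ := exists_lt_of_csInf_lt (hf.nonempty.image Φ)
        (lt_add_of_pos_right I (by positivity : (0 : ℝ) < 1 / ((k : ℝ) + 1)))
      exact ⟨x, hx, h.le⟩) (B := ‖u‖ + (1 + (I + 1 - 2 * τ * m))) (fun w hw => by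
      have h1 := hw.2
      have := mul_le_mul_of_nonneg_left (hm w hw.1) (by positivity : 0 ≤ 2 * τ)
      simp only [hΦ] at h1
      norm_num at h1
      have h2 : ‖w‖ ≤ ‖u‖ + ‖w - u‖ := norm_le_norm_add_norm_sub' w u
      nlinarith [sq_nonneg (‖w - u‖ - 1)])
  have hex : ∀ k : ℕ, ∃ y, (y ∈ D ∧ Φ y ≤ I + 1 / ((k : ℝ) + 1)) ∧
      dist U y < 1 / ((k : ℝ) + 1) := fun k => by
    obtain ⟨y, hy, hd⟩ := Metric.mem_closure_iff.1 (hU k) (1 / ((k : ℝ) + 1)) (by positivity)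
    exact ⟨y, hy, hd⟩
  choose y hy hyd using hex
  have hyU : Tendsto y atTop (𝓝 U) := by
    rw [tendsto_iff_dist_tendsto_zero]
    refine squeeze_zero (fun _ => dist_nonneg) (fun k => ?_)
      tendsto_one_div_add_atTop_nhds_zero_nat
    rw [dist_comm]
    exact (hyd k).le
  -- Lower semicontinuity of `f` along the approximating `y k`. The quadratic part of `Φ` converges,
  -- so it moves to the right-hand side.
  have hUD : ∀ ε > 0, U ∈ D ∧ f U ≤ (I - ‖U - u‖ ^ 2) / (2 * τ) + ε := fun ε hε => by
    refine hf.mem_of_tendsto hyU ?_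
    have h1 : Tendsto (fun k : ℕ => (I + 1 / ((k : ℝ) + 1) - ‖y k - u‖ ^ 2) / (2 * τ)) atTop
        (𝓝 ((I + 0 - ‖U - u‖ ^ 2) / (2 * τ))) :=
      ((tendsto_const_nhds.add tendsto_one_div_add_atTop_nhds_zero_nat).sub
        ((hyU.sub_const u).norm.pow 2)).div_const _
    rw [add_zero] at h1
    filter_upwards [h1.eventually (gt_mem_nhds (lt_add_of_pos_right _ hε))] with k hk
    refine ⟨(hy k).1, le_trans ?_ hk.le⟩
    rw [le_div_iff₀ (by positivity)]
    have := (hy k).2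
    simp only [hΦ] at this
    linarith
  have hUm : U ∈ D := (hUD 1 one_pos).1
  have hUI : Φ U ≤ I := by
    have : f U ≤ (I - ‖U - u‖ ^ 2) / (2 * τ) :=
      le_of_forall_pos_le_add fun ε hε => (hUD ε hε).2
    rw [le_div_iff₀ (by positivity)] at this
    simp only [hΦ]
    linarith
  refine ⟨U, hUm, fun w hw => ?_⟩
  -- Compare the minimiser `U` with `(1 - θ) U + θ w`, use convexity of `f` and divide by `θ`. As `θ
  -- → 0` only the first-order terms remain.
  have hθ : ∀ θ : ℝ, 0 < θ → θ < 1 →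
      0 ≤ 2 * τ * (f w - f U) + 2 * inner ℝ (U - u) (w - U) + θ * ‖w - U‖ ^ 2 := by
    intro θ h0 h1
    have h2 := hf.convexOn.2 hUm hw (by linarith : 0 ≤ 1 - θ) h0.le (by ring)
    have h3 := hI _ (hf.convexOn.1 hUm hw (by linarith : 0 ≤ 1 - θ) h0.le (by ring))
    have h4 : (1 - θ) • U + θ • w - u = (U - u) + θ • (w - U) := by module
    have h5 := norm_add_sq_real (U - u) (θ • (w - U))
    rw [real_inner_smul_right, norm_smul, Real.norm_of_nonneg h0.le] at h5
    simp only [hΦ] at h3 hUI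
    rw [h4, h5] at h3
    simp only [smul_eq_mul] at h2
    have h6 := mul_le_mul_of_nonneg_left h2 (by positivity : 0 ≤ 2 * τ)
    refine nonneg_of_mul_nonneg_right (a := θ) ?_ h0
    nlinarith
  have hlim : Tendsto (fun θ : ℝ => 2 * τ * (f w - f U) + 2 * inner ℝ (U - u) (w - U)
      + θ * ‖w - U‖ ^ 2) (𝓝[>] 0)
      (𝓝 (2 * τ * (f w - f U) + 2 * inner ℝ (U - u) (w - U) + 0 * ‖w - U‖ ^ 2)) :=
    (Continuous.tendsto (by fun_prop) 0).mono_left nhdsWithin_le_nhds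
  have h0 : 0 ≤ 2 * τ * (f w - f U) + 2 * inner ℝ (U - u) (w - U) + 0 * ‖w - U‖ ^ 2 := by
    refine ge_of_tendsto hlim ?_
    filter_upwards [Ioo_mem_nhdsGT one_pos] with θ h using hθ θ h.1 h.2
  have h1 := norm_sub_sq_real (U - u) (U - w)
  have h2 : U - u - (U - w) = -(u - w) := by abel
  rw [h2, norm_neg] at h1
  have h3 : inner ℝ (U - u) (U - w) = - inner ℝ (U - u) (w - U) := by
    rw [← neg_sub w U, inner_neg_right]
  rw [h3] at h1
  linarith

end ConvexEnergy

/-! ### The evolution variational inequality: contraction and existence -/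

section Evolution

set_option linter.unusedSectionVars false

variable {H : Type*} [NormedAddCommGroup H] [InnerProductSpace ℝ H] {D : Set H} {f : H → ℝ}

/-- `u` solves the evolution variational inequality of `f` on `[0,∞)`. -/
structure IsEVI (D : Set H) (f : H → ℝ) (u : ℝ → H) : Prop where
  continuousOn : ContinuousOn u (Ici 0)
  mem : ∀ t, 0 < t → u t ∈ D
  evi : ∀ w ∈ D, ∀ s t, 0 ≤ s → s < t →
    ‖u t - w‖ ^ 2 - ‖u s - w‖ ^ 2 ≤ 2 * (t - s) * (f w - f (u t))

namespace IsEVI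

variable {u v : ℝ → H}

theorem shift (hu : IsEVI D f u) {a : ℝ} (ha : 0 ≤ a) : IsEVI D f fun t => u (a + t) where
  continuousOn := hu.continuousOn.comp (by fun_prop) fun t ht => add_nonneg ha ht
  mem t ht := hu.mem _ (by linarith)
  evi w hw s t hs hst := by
    have := hu.evi w hw (a + s) (a + t) (by linarith) (by linarith)
    rwa [add_sub_add_left_eq_sub] at this

theorem sq_norm_sub_le (hu : IsEVI D f u) {s t : ℝ} (hs : 0 ≤ s) (hst : s ≤ t) (hsD : u s ∈ D) :
    ‖u t - u s‖ ^ 2 ≤ 2 * (t - s) * (f (u s) - f (u t)) := by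
  rcases hst.eq_or_lt with rfl | h
  · simp
  · simpa using hu.evi (u s) hsD s t hs h

theorem energy_le (hu : IsEVI D f u) {s t : ℝ} (hs : 0 ≤ s) (hst : s ≤ t) (hsD : u s ∈ D) :
    f (u t) ≤ f (u s) := by
  rcases hst.eq_or_lt with rfl | h
  · exact le_rfl
  · have h1 := hu.sq_norm_sub_le hs hst hsD
    have h2 := (sq_nonneg ‖u t - u s‖).trans h1
    have h3 : 0 < 2 * (t - s) := by linarith
    linarith [nonneg_of_mul_nonneg_right h2 h3]

theorem antitoneOn (hu : IsEVI D f u) : AntitoneOn (fun t => f (u t)) (Ioi 0) :=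
  fun s hs _ _ hst => hu.energy_le (le_of_lt hs) hst (hu.mem s hs)

/-- Two solutions of the evolution variational inequality approach each other. -/
theorem norm_sub_le (hu : IsEVI D f u) (hv : IsEVI D f v) {s t : ℝ} (hs : 0 ≤ s) (hst : s ≤ t) :
    ‖u t - v t‖ ≤ ‖u s - v s‖ := by
  have hpos : ∀ s, 0 < s → s ≤ t → ‖u t - v t‖ ≤ ‖u s - v s‖ := by
    intro s hs hst
    -- Over one step from `r` to `r'`, test the inequality for `u` with `v r'` and the one for `v`
    -- with `u r`. The mixed distances and `f (v r')` cancel, leaving `2 h (f (u r) - f (u r'))`.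
    -- This telescopes, and its sum vanishes as `h → 0`.
    have hstep : ∀ h, 0 < h → ∀ k : ℕ, ‖u (s + k * h) - v (s + k * h)‖ ^ 2 - ‖u s - v s‖ ^ 2 ≤
        2 * h * (f (u s) - f (u (s + k * h))) := by
      intro h hh k
      induction k with
      | zero => simp
      | succ k ih =>
        have hr : 0 < s + k * h := by positivity
        have hr' : s + k * h < s + (k + 1 : ℕ) * h := by push_cast; linarith
        have e : s + (k + 1 : ℕ) * h - (s + k * h) = h := by push_cast; ring
        set r := s + k * h
        set r' := s + (k + 1 : ℕ) * h
        have h1 := hu.evi (v r') (hv.mem r' (hr.trans hr')) r r' hr.le hr'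
        have h2 := hv.evi (u r) (hu.mem r hr) r r' hr.le hr'
        rw [e] at h1 h2
        rw [norm_sub_rev (v r'), norm_sub_rev (v r)] at h2
        linarith
    have hlim : Tendsto (fun M : ℕ => ‖u s - v s‖ ^ 2 +
        2 * ((t - s) * (1 / ((M : ℝ) + 1))) * (f (u s) - f (u t))) atTop
        (𝓝 (‖u s - v s‖ ^ 2 + 2 * ((t - s) * 0) * (f (u s) - f (u t)))) :=
      tendsto_const_nhds.add (((tendsto_one_div_add_atTop_nhds_zero_nat.const_mul _).const_mul _
        ).mul_const _)
    refine (sq_le_sq₀ (norm_nonneg _) (norm_nonneg _)).1 ?_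
    refine (ge_of_tendsto hlim (Eventually.of_forall fun M => ?_)).trans (by simp)
    rcases hst.eq_or_lt with rfl | hlt
    · simp
    have := hstep ((t - s) * (1 / ((M : ℝ) + 1))) (mul_pos (by linarith) (by positivity)) (M + 1)
    have e : s + (M + 1 : ℕ) * ((t - s) * (1 / ((M : ℝ) + 1))) = t := by
      push_cast
      field_simp
      ring
    rw [e] at this
    linarith
  rcases hs.eq_or_lt with rfl | hs
  · rcases hst.eq_or_lt with rfl | ht
    · exact le_rfl
    have h1 : Tendsto (fun s => ‖u s - v s‖) (𝓝[>] 0) (𝓝 ‖u 0 - v 0‖) :=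
      (((hu.continuousOn 0 self_mem_Ici).mono Ioi_subset_Ici_self).sub
        ((hv.continuousOn 0 self_mem_Ici).mono Ioi_subset_Ici_self)).norm
    refine ge_of_tendsto h1 ?_
    filter_upwards [Ioo_mem_nhdsGT ht] with s hs using hpos s hs.1 hs.2.le
  · exact hpos s hs hst

/-- The increments over intervals of fixed length decrease. -/
theorem norm_increment_le (hu : IsEVI D f u) {s t h : ℝ} (hs : 0 ≤ s) (hst : s ≤ t) (hh : 0 ≤ h) :
    ‖u (t + h) - u t‖ ≤ ‖u (s + h) - u s‖ := by
  have := (hu.shift hh).norm_sub_le hu hs hst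
  rwa [add_comm h, add_comm h] at this

end IsEVI

/-- The evolution variational inequality passes to limits. -/
theorem ConvexEnergy.evi_of_tendsto (hf : ConvexEnergy D f) {a b : ℕ → H} {x y : H}
    (ha : Tendsto a atTop (𝓝 x)) (hb : Tendsto b atTop (𝓝 y)) {c : ℕ → ℝ} {r : ℝ} (hr : 0 < r)
    (hc : Tendsto c atTop (𝓝 r)) (haD : ∀ i, a i ∈ D)
    (h : ∀ w ∈ D, ∀ i, ‖a i - w‖ ^ 2 - ‖b i - w‖ ^ 2 ≤ 2 * c i * (f w - f (a i))) :
    x ∈ D ∧ ∀ w ∈ D, ‖x - w‖ ^ 2 - ‖y - w‖ ^ 2 ≤ 2 * r * (f w - f x) := by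
  have hcpos : ∀ᶠ i in atTop, 0 < c i := hc.eventually (lt_mem_nhds hr)
  have hn : ∀ w : H, Tendsto (fun i => ‖a i - w‖ ^ 2 - ‖b i - w‖ ^ 2) atTop
      (𝓝 (‖x - w‖ ^ 2 - ‖y - w‖ ^ 2)) := fun w =>
    ((ha.sub_const w).norm.pow 2).sub ((hb.sub_const w).norm.pow 2)
  -- Tested with one fixed `w`, the inequality bounds `f (a i)` from above, so the limit stays in a
  -- sublevel set.
  have hx : x ∈ D := by
    obtain ⟨w, hw⟩ := hf.nonempty
    have h1 : Tendsto (fun i => f w - (‖a i - w‖ ^ 2 - ‖b i - w‖ ^ 2) / (2 * c i)) atTop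
        (𝓝 (f w - (‖x - w‖ ^ 2 - ‖y - w‖ ^ 2) / (2 * r))) :=
      tendsto_const_nhds.sub ((hn w).div (hc.const_mul 2) (by positivity))
    refine (hf.mem_of_tendsto ha (c := f w - (‖x - w‖ ^ 2 - ‖y - w‖ ^ 2) / (2 * r) + 1) ?_).1
    filter_upwards [h1.eventually (gt_mem_nhds (lt_add_one _)), hcpos] with i hi hci
    refine ⟨haD i, le_trans ?_ hi.le⟩
    have := (div_le_iff₀' (by positivity : 0 < 2 * c i)).2 (h w hw i)
    linarith
  refine ⟨hx, fun w hw => le_of_forall_pos_le_add fun ε hε => ?_⟩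
  have hlt := hf.eventually_lt ha (Eventually.of_forall haD)
    (sub_lt_self (f x) (by positivity : 0 < ε / (2 * r)))
  have h1 : ‖x - w‖ ^ 2 - ‖y - w‖ ^ 2 ≤ 2 * r * (f w - (f x - ε / (2 * r))) := by
    refine le_of_tendsto_of_tendsto (hn w) ((hc.const_mul 2).mul_const _) ?_
    filter_upwards [hlt, hcpos] with i hi hci
    exact (h w hw i).trans (mul_le_mul_of_nonneg_left (by linarith) (by positivity))
  refine h1.trans (le_of_eq ?_)
  field_simp
  ring

/-! ### Implicit Euler schemes -/

section Euler

/-- An implicit Euler scheme with step `τ`. -/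
structure IsEuler (D : Set H) (f : H → ℝ) (τ : ℝ) (U : ℕ → H) : Prop where
  mem : ∀ k, U k ∈ D
  step : ∀ k, ∀ w ∈ D, ‖U (k + 1) - w‖ ^ 2 - ‖U k - w‖ ^ 2 + ‖U (k + 1) - U k‖ ^ 2 ≤
    2 * τ * (f w - f (U (k + 1)))

theorem ConvexEnergy.exists_isEuler [CompleteSpace H] (hf : ConvexEnergy D f) {τ : ℝ} (hτ : 0 < τ)
    {u₀ : H} (hu₀ : u₀ ∈ D) : ∃ U, IsEuler D f τ U ∧ U 0 = u₀ := by
  choose P hPD hP using fun u => hf.exists_prox hτ u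
  refine ⟨fun k => P^[k] u₀, ⟨fun k => ?_, fun k w hw => ?_⟩, rfl⟩
  · cases k with
    | zero => exact hu₀
    | succ k => rw [Function.iterate_succ_apply']; exact hPD _
  · rw [Function.iterate_succ_apply']
    exact hP _ w hw

variable {τ : ℝ} {U V : ℕ → H}

theorem IsEuler.sq_norm_sub_le (hU : IsEuler D f τ U) (k : ℕ) :
    ‖U (k + 1) - U k‖ ^ 2 ≤ τ * (f (U k) - f (U (k + 1))) := by
  have := hU.step k (U k) (hU.mem k)
  simp only [sub_self, norm_zero] at this
  linarith

theorem IsEuler.antitone (hU : IsEuler D f τ U) (hτ : 0 < τ) : Antitone fun k => f (U k) :=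
  antitone_nat_of_succ_le fun k => by
    have := (sq_nonneg _).trans (hU.sq_norm_sub_le k)
    linarith [nonneg_of_mul_nonneg_right this hτ]

/-- Summing the one-step inequalities and replacing every intermediate energy by the last, smallest
one gives the evolution inequality between grid times. -/
theorem IsEuler.evi (hU : IsEuler D f τ U) (hτ : 0 < τ) {w : H} (hw : w ∈ D) (j k : ℕ) :
    ‖U (j + k) - w‖ ^ 2 - ‖U j - w‖ ^ 2 ≤ 2 * (k * τ) * (f w - f (U (j + k))) := by
  induction k with
  | zero => simp
  | succ k ih =>
    have h1 := hU.step (j + k) w hw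
    have h2 := hU.antitone hτ (Nat.le_succ (j + k))
    have h3 := sq_nonneg ‖U (j + k + 1) - U (j + k)‖
    have h4 := mul_le_mul_of_nonneg_left h2 (by positivity : 0 ≤ 2 * (k * τ))
    simp only [Nat.succ_eq_add_one] at h4
    rw [← add_assoc]
    push_cast
    linarith

/-- Halving the step of an implicit Euler scheme changes it little. -/
theorem IsEuler.sq_norm_sub_halved_le (hU : IsEuler D f τ U) (hV : IsEuler D f (τ / 2) V)
    (hτ : 0 < τ) (h0 : V 0 = U 0) (k : ℕ) :
    ‖V (2 * k) - U k‖ ^ 2 ≤ 2 * τ * (f (V 0) - f (V (2 * k))) := by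
  induction k with
  | zero => simp [h0]
  | succ k ih =>
    -- Two half steps of `V` are tested with the new point of `U`, and one step of `U` with the old
    -- point of `V`. Distances and energies cancel as in the contraction estimate, and the remainder
    -- telescopes.
    have h1 := hV.evi (half_pos hτ) (hU.mem (k + 1)) (2 * k) 2
    have h2 := hU.step k (V (2 * k)) (hV.mem _)
    rw [norm_sub_rev (U (k + 1)), norm_sub_rev (U k)] at h2
    have h3 := sq_nonneg ‖U (k + 1) - U k‖
    rw [mul_add, mul_one]
    push_cast at h1
    linarith

end Euler

/-- The gradient flow started at a point of finite energy. -/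
theorem ConvexEnergy.exists_isEVI_of_mem [CompleteSpace H] (hf : ConvexEnergy D f) {u₀ : H}
    (hu₀ : u₀ ∈ D) : ∃ u, IsEVI D f u ∧ u 0 = u₀ := by
  obtain ⟨m, hm⟩ := hf.bddBelow
  have hτ : ∀ i : ℕ, (0 : ℝ) < (1 / 2) ^ i := fun i => by positivity
  choose U hU hU0 using fun i => hf.exists_isEuler (hτ i) hu₀
  set M : ℝ := f u₀ - m with hM
  have hM0 : 0 ≤ M := sub_nonneg.2 (hm _ hu₀)
  have hgrid : ∀ i k, ‖U (i + 1) (2 * k) - U i k‖ ^ 2 ≤ 2 * (1 / 2) ^ i * M := fun i k => by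
    have h1 : IsEuler D f ((1 / 2) ^ i / 2) (U (i + 1)) := by
      have := hU (i + 1)
      rwa [pow_succ, mul_one_div] at this
    refine ((hU i).sq_norm_sub_halved_le h1 (hτ i) ((hU0 _).trans (hU0 _).symm) k).trans ?_
    rw [hU0]
    have h2 : f u₀ - f (U (i + 1) (2 * k)) ≤ M :=
      sub_le_sub_left (hm _ ((hU (i + 1)).mem (2 * k))) _
    have := hτ i
    gcongr
  have hle : ∀ i k, f (U i k) ≤ f u₀ := fun i k => by
    have := (hU i).antitone (hτ i) (Nat.zero_le k)
    simpa only [hU0] using this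
  have hstep : ∀ i k, ‖U i (k + 1) - U i k‖ ^ 2 ≤ (1 / 2) ^ i * M := fun i k => by
    refine ((hU i).sq_norm_sub_le k).trans ?_
    have h1 : f (U i k) - f (U i (k + 1)) ≤ M :=
      sub_le_sub (hle i k) (hm _ ((hU i).mem (k + 1)))
    have := hτ i
    gcongr
  set ρ : ℝ := √(1 / 2) with hρ
  have hρ0 : 0 ≤ ρ := Real.sqrt_nonneg _
  have hρ1 : ρ < 1 := by rw [hρ, Real.sqrt_lt' one_pos]; norm_num
  have hρi : ∀ i : ℕ, (ρ ^ i) ^ 2 = (1 / 2) ^ i := fun i => by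
    rw [← pow_mul, mul_comm, pow_mul, hρ, Real.sq_sqrt (by norm_num)]
  -- Square roots of the grid estimates. The constant only has to satisfy `2 M ≤ (2 (M + 1))²`.
  have hsq : ∀ (x : H) (i : ℕ), ‖x‖ ^ 2 ≤ 2 * (1 / 2) ^ i * M → ‖x‖ ≤ 2 * (M + 1) * ρ ^ i := by
    intro x i h
    refine (sq_le_sq₀ (norm_nonneg _) (by positivity)).1 (h.trans ?_)
    rw [mul_pow, hρi]
    have := hτ i
    nlinarith [mul_nonneg this.le hM0, mul_nonneg (mul_nonneg this.le hM0) hM0]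
  set a : ℕ → ℝ → H := fun i t => U i ⌊t * 2 ^ i⌋₊ with ha
  have hcau : ∀ t, 0 ≤ t → ∀ i, dist (a i t) (a (i + 1) t) ≤ 4 * (M + 1) * ρ ^ i := by
    intro t ht i
    have h0 : 0 ≤ t * 2 ^ i := by positivity
    have hfl := Nat.floor_le h0
    have hfl' := Nat.lt_floor_add_one (t * 2 ^ i)
    set k := ⌊t * 2 ^ i⌋₊ with hk
    -- Refining the grid doubles the index, up to one additional half step. That step is controlled
    -- by `hstep`.
    have hcase : ⌊t * 2 ^ (i + 1)⌋₊ = 2 * k ∨ ⌊t * 2 ^ (i + 1)⌋₊ = 2 * k + 1 := by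
      have h1 : 2 * k ≤ ⌊t * 2 ^ (i + 1)⌋₊ := by
        refine Nat.le_floor ?_
        push_cast
        rw [pow_succ]
        linarith
      have h2 : ⌊t * 2 ^ (i + 1)⌋₊ < 2 * k + 2 := by
        refine (Nat.floor_lt (by positivity)).2 ?_
        push_cast
        rw [pow_succ]
        linarith
      omega
    have h1 := hsq _ i (hgrid i k)
    have h2 := hsq (U (i + 1) (2 * k + 1) - U (i + 1) (2 * k)) i ((hstep (i + 1) (2 * k)).trans (by
      rw [pow_succ]
      have := mul_nonneg (hτ i).le hM0
      linarith))
    have h3 : 0 ≤ 2 * (M + 1) * ρ ^ i := by positivity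
    rw [dist_eq_norm, norm_sub_rev]
    simp only [ha, ← hk]
    rcases hcase with h | h <;> rw [h]
    · linarith
    · have := norm_sub_le_norm_sub_add_norm_sub (U (i + 1) (2 * k + 1)) (U (i + 1) (2 * k)) (U i k)
      linarith
  have hex : ∀ t, ∃ x, 0 ≤ t → Tendsto (fun i => a i t) atTop (𝓝 x) := fun t => by
    by_cases ht : 0 ≤ t
    · obtain ⟨x, hx⟩ := cauchySeq_tendsto_of_complete
        (cauchySeq_of_le_geometric ρ _ hρ1 (hcau t ht))
      exact ⟨x, fun _ => hx⟩
    · exact ⟨0, fun h => absurd h ht⟩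
  choose u hu using hex
  have hmem : ∀ t, 0 ≤ t → u t ∈ D ∧ f (u t) ≤ f u₀ := fun t ht =>
    hf.mem_of_tendsto (hu t ht) (Eventually.of_forall fun i => ⟨(hU i).mem _, hle i _⟩)
  have hevi : ∀ w ∈ D, ∀ s t, 0 ≤ s → s < t →
      ‖u t - w‖ ^ 2 - ‖u s - w‖ ^ 2 ≤ 2 * (t - s) * (f w - f (u t)) := by
    intro w hw s t hs hst
    have ht : 0 ≤ t := hs.trans hst.le
    have hfloor : ∀ r : ℝ, 0 ≤ r →
        Tendsto (fun i : ℕ => (⌊r * 2 ^ i⌋₊ : ℝ) * (1 / 2) ^ i) atTop (𝓝 r) := by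
      intro r hr
      have h1 := (tendsto_nat_floor_mul_div_atTop hr).comp
        (tendsto_pow_atTop_atTop_of_one_lt (one_lt_two : (1 : ℝ) < 2))
      refine h1.congr fun i => ?_
      simp [div_eq_mul_inv]
    refine (hf.evi_of_tendsto (hu t ht) (hu s hs) (c := fun i =>
      (⌊t * 2 ^ i⌋₊ : ℝ) * (1 / 2) ^ i - (⌊s * 2 ^ i⌋₊ : ℝ) * (1 / 2) ^ i) (sub_pos.2 hst)
      ((hfloor t ht).sub (hfloor s hs)) (fun i => (hU i).mem _) fun w hw i => ?_).2 w hw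
    obtain ⟨k, hk⟩ := Nat.exists_eq_add_of_le (Nat.floor_mono
      (mul_le_mul_of_nonneg_right hst.le (by positivity : (0 : ℝ) ≤ 2 ^ i)))
    have := (hU i).evi (hτ i) hw ⌊s * 2 ^ i⌋₊ k
    simp only [ha, hk]
    push_cast
    rw [add_mul, add_sub_cancel_left]
    exact this
  refine ⟨u, ⟨?_, fun t ht => (hmem t ht.le).1, hevi⟩, ?_⟩
  -- Testing with `w = u s` gives Hölder continuity of exponent `1/2`, with a constant that depends
  -- only on the initial energy and the lower bound.
  · have hhold : ∀ s t, 0 ≤ s → s ≤ t → ‖u t - u s‖ ^ 2 ≤ 2 * (t - s) * M := by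
      intro s t hs hst
      rcases hst.eq_or_lt with rfl | hlt
      · simp
      have h1 := hevi (u s) (hmem s hs).1 s t hs hlt
      simp only [sub_self, norm_zero] at h1
      have h2 : f (u s) - f (u t) ≤ M :=
        sub_le_sub (hmem s hs).2 (hm _ (hmem t (hs.trans hst)).1)
      have h3 := mul_le_mul_of_nonneg_left h2 (by linarith : 0 ≤ 2 * (t - s))
      linarith
    intro s hs
    have h2 : Tendsto (fun t => √(2 * |t - s| * M)) (𝓝[Ici 0] s) (𝓝 √(2 * |s - s| * M)) :=
      (Continuous.tendsto (by fun_prop) s).mono_left nhdsWithin_le_nhds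
    rw [sub_self, abs_zero, mul_zero, zero_mul, Real.sqrt_zero] at h2
    refine tendsto_iff_norm_sub_tendsto_zero.2 (squeeze_zero' (Eventually.of_forall fun _ =>
      norm_nonneg _) ?_ h2)
    filter_upwards [self_mem_nhdsWithin] with t ht
    refine Real.le_sqrt_of_sq_le ?_
    rcases le_total s t with h | h
    · rw [abs_of_nonneg (sub_nonneg.2 h)]
      exact hhold s t hs h
    · rw [abs_of_nonpos (sub_nonpos.2 h), norm_sub_rev, neg_sub]
      exact hhold t s ht h
  · refine tendsto_nhds_unique (hu 0 le_rfl) ?_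
    simp [ha, hU0]

/-- The gradient flow started in the closure of the points of finite energy. -/
theorem ConvexEnergy.exists_isEVI [CompleteSpace H] (hf : ConvexEnergy D f) {u₀ : H}
    (hu₀ : u₀ ∈ closure D) : ∃ u, IsEVI D f u ∧ u 0 = u₀ := by
  obtain ⟨x, hxD, hx⟩ := mem_closure_iff_seq_limit.1 hu₀
  choose S hS hS0 using fun k => hf.exists_isEVI_of_mem (hxD k)
  -- Contraction makes the approximating flows uniformly Cauchy on `[0, ∞)`, so the limit is
  -- continuous up to time zero.
  have hdist : ∀ t, 0 ≤ t → ∀ k l, dist (S k t) (S l t) ≤ dist (x k) (x l) := by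
    intro t ht k l
    have := (hS k).norm_sub_le (hS l) le_rfl ht
    rwa [hS0, hS0, ← dist_eq_norm, ← dist_eq_norm] at this
  have hcau : UniformCauchySeqOn S atTop (Ici 0) := by
    refine Metric.uniformCauchySeqOn_iff.2 fun ε hε => ?_
    obtain ⟨K, hK⟩ := Metric.cauchySeq_iff.1 hx.cauchySeq ε hε
    exact ⟨K, fun k hk l hl t ht => (hdist t ht k l).trans_lt (hK k hk l hl)⟩
  have hex : ∀ t, ∃ y, t ∈ Ici (0 : ℝ) → Tendsto (fun k => S k t) atTop (𝓝 y) := fun t => by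
    by_cases ht : t ∈ Ici (0 : ℝ)
    · obtain ⟨y, hy⟩ := cauchySeq_tendsto_of_complete (hcau.cauchySeq ht)
      exact ⟨y, fun _ => hy⟩
    · exact ⟨0, fun h => absurd h ht⟩
  choose u hu using hex
  have hunif := hcau.tendstoUniformlyOn_of_tendsto fun t ht => hu t ht
  -- The case `s = 0` places `u t` in `D` for every `t > 0`, even when the initial datum lies only
  -- in the closure of `D`.
  have hlim : ∀ s t, 0 ≤ s → s < t → u t ∈ D ∧ ∀ w ∈ D,
      ‖u t - w‖ ^ 2 - ‖u s - w‖ ^ 2 ≤ 2 * (t - s) * (f w - f (u t)) := fun s t hs hst =>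
    hf.evi_of_tendsto (hu t (hs.trans hst.le)) (hu s hs) (sub_pos.2 hst) tendsto_const_nhds
      (fun i => (hS i).mem t (hs.trans_lt hst)) fun w hw i => (hS i).evi w hw s t hs hst
  refine ⟨u, ⟨hunif.continuousOn (Frequently.of_forall fun k => (hS k).continuousOn),
    fun t ht => (hlim 0 t le_rfl ht).1, fun w hw s t hs hst => (hlim s t hs hst).2 w hw⟩, ?_⟩
  refine tendsto_nhds_unique (hu 0 self_mem_Ici) ?_
  simpa only [hS0] using hx

end Evolution

/-! ### Regularisation, the right derivative and the energy identity -/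

section Derivative

variable {H : Type*} [NormedAddCommGroup H] [InnerProductSpace ℝ H] {D : Set H} {f : H → ℝ}
  {u : ℝ → H}

/-- Expand `‖u (s + h) - w‖²` around `u s` in the evolution inequality, discard the square of the
increment and divide by `2 h`. The energy on the left is still the one at time `s + h`. -/
theorem IsEVI.inner_slope_le (hu : IsEVI D f u) {s h : ℝ} (hs : 0 ≤ s) (hh : 0 < h) {w : H}
    (hw : w ∈ D) :
    f (u (s + h)) + inner ℝ (-(h⁻¹ • (u (s + h) - u s))) (w - u s) ≤ f w := by
  have h1 := hu.evi w hw s (s + h) hs (by linarith)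
  have h2 := norm_sub_sq_real (u (s + h) - u s) (w - u s)
  rw [sub_sub_sub_cancel_right, norm_sub_rev w] at h2
  rw [inner_neg_left, real_inner_smul_left]
  have h3 := sq_nonneg ‖u (s + h) - u s‖
  have h4 : h * (h⁻¹ * inner ℝ (u (s + h) - u s) (w - u s)) =
      inner ℝ (u (s + h) - u s) (w - u s) := by field_simp
  refine le_of_mul_le_mul_left ?_ hh
  nlinarith

/-- Lower semicontinuity exchanges `f (u (s + h))` for `f (u s) - ε`, which makes the negative
difference quotients approximate subgradients at `u s`. -/
theorem ConvexEnergy.eventually_approx_subgrad (hf : ConvexEnergy D f) (hu : IsEVI D f u) {s : ℝ}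
    (hs : 0 ≤ s) {ι : Type*} {l : Filter ι} {h : ι → ℝ} (hl : Tendsto h l (𝓝[>] 0)) {w : H}
    (hw : w ∈ D) {ε : ℝ} (hε : 0 < ε) :
    ∀ᶠ k in l, f (u s) + inner ℝ (-((h k)⁻¹ • (u (s + h k) - u s))) (w - u s) ≤ f w + ε := by
  have hpos : ∀ᶠ k in l, 0 < h k := hl.eventually self_mem_nhdsWithin
  have hlim : Tendsto (fun k => u (s + h k)) l (𝓝 (u s)) := by
    refine (hu.continuousOn s hs).tendsto.comp (tendsto_nhdsWithin_iff.2 ⟨?_, ?_⟩)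
    · simpa using (hl.mono_right nhdsWithin_le_nhds).const_add s
    · filter_upwards [hpos] with k hk using add_nonneg hs hk.le
  have h1 := hf.eventually_lt hlim (by
    filter_upwards [hpos] with k hk using hu.mem _ (by linarith)) (sub_lt_self (f (u s)) hε)
  filter_upwards [h1, hpos] with k h1 h2
  have := hu.inner_slope_le hs h2 hw
  linarith

/-- Regularisation: for positive times the flow is in the domain of the subdifferential. -/
theorem ConvexEnergy.subgrad_nonempty [CompleteSpace H] (hf : ConvexEnergy D f)
    (hu : IsEVI D f u) {t : ℝ} (ht : 0 < t) : (subgrad D f (u t)).Nonempty := by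
  obtain ⟨m, hm⟩ := hf.bddBelow
  set s := t / 2 with hs
  have hs0 : 0 < s := half_pos ht
  -- Each squared increment is at most `2 h` times the energy drop over its step. Increments
  -- decrease in time, so the last one is bounded by the average of the earlier ones.
  have hsum : ∀ h, 0 < h → ∀ k : ℕ, k * ‖u (s + k * h + h) - u (s + k * h)‖ ^ 2 ≤
      2 * h * (f (u s) - f (u (s + k * h))) := by
    intro h hh k
    induction k with
    | zero => simp
    | succ k ih =>
      have e : s + (k + 1 : ℕ) * h = s + k * h + h := by push_cast; ring
      have hr : 0 < s + k * h := by positivity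
      rw [e]
      set r := s + k * h
      have h1 : ‖u (r + h + h) - u (r + h)‖ ^ 2 ≤ ‖u (r + h) - u r‖ ^ 2 := by
        have := hu.norm_increment_le hr.le (by linarith : r ≤ r + h) hh.le
        gcongr
      have h2 := hu.sq_norm_sub_le hr.le (by linarith : r ≤ r + h) (hu.mem r hr)
      rw [add_sub_cancel_left] at h2
      have h3 := mul_le_mul_of_nonneg_left h1 (by positivity : (0 : ℝ) ≤ k + 1)
      push_cast
      linarith
  -- With this step length, `k + 1` steps lead from `s = t / 2` exactly to `t`. The resulting bound
  -- on the slope at `t` does not depend on `k`.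
  set h : ℕ → ℝ := fun k => s * (1 / ((k : ℝ) + 1)) with hh
  have hpos : ∀ k, 0 < h k := fun k => by positivity
  have hlim : Tendsto h atTop (𝓝[>] 0) := by
    refine tendsto_nhdsWithin_iff.2 ⟨?_, Eventually.of_forall hpos⟩
    simpa only [mul_zero] using tendsto_one_div_add_atTop_nhds_zero_nat.const_mul s
  obtain ⟨x, hx, -⟩ := exists_subgrad_of_approx (hu.mem t ht)
    (v := fun k => -((h k)⁻¹ • (u (t + h k) - u t))) (R := √(2 * (f (u s) - m) / s)) (fun k => by
      have e1 : ((k + 1 : ℕ) : ℝ) * h k = s := by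
        simp only [hh]
        push_cast
        field_simp
      have h1 := hsum (h k) (hpos k) (k + 1)
      rw [e1, hs, add_halves, ← hs] at h1
      have h2 : 2 * h k * (f (u s) - f (u t)) ≤ 2 * h k * (f (u s) - m) := by
        have := hm _ (hu.mem t ht)
        have := hpos k
        gcongr
      have hp := hpos k
      have h3 := mul_le_mul_of_nonneg_right (h1.trans h2) hp.le
      have h4 : ‖u (t + h k) - u t‖ ^ 2 * s ≤ 2 * (f (u s) - m) * h k ^ 2 := by
        calc _ = (k + 1 : ℕ) * ‖u (t + h k) - u t‖ ^ 2 * h k := by rw [← e1]; ring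
          _ ≤ _ := h3
          _ = _ := by ring
      refine Real.le_sqrt_of_sq_le ?_
      rwa [norm_neg, norm_smul, norm_inv, Real.norm_of_nonneg hp.le, mul_pow, le_div_iff₀ hs0,
        inv_pow, inv_mul_eq_div, div_mul_eq_mul_div, div_le_iff₀ (by positivity)]) fun w hw ε hε =>
      hf.eventually_approx_subgrad hu ht.le hlim hw hε
  exact ⟨x, hx⟩

/-- The speed of the flow is at most the norm of any subgradient at the starting point. -/
theorem IsEVI.norm_sub_le_of_subgrad (hu : IsEVI D f u) {s h : ℝ} (hs : 0 ≤ s) (hh : 0 ≤ h)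
    {z : H} (hz : z ∈ subgrad D f (u s)) : ‖u (s + h) - u s‖ ≤ h * ‖z‖ := by
  rcases hh.eq_or_lt with rfl | hh
  · simp
  -- With `a = η ‖z‖`, the evolution inequality tested with `u s`, together with the subgradient
  -- inequality, gives `(‖x‖ - a)² ≤ a² + ‖previous x‖²`. The term `2 √k` absorbs the accumulated
  -- `a²`.
  have hstep : ∀ η, 0 < η → ∀ k : ℕ,
      ‖u (s + k * η) - u s‖ ≤ η * ‖z‖ * (k + 2 * √k) := by
    intro η hη k
    induction k with
    | zero => simp
    | succ k ih =>
      have hr : 0 ≤ s + k * η := by positivity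
      have hr' : s + k * η < s + (k + 1 : ℕ) * η := by push_cast; linarith
      have e : s + (k + 1 : ℕ) * η - (s + k * η) = η := by push_cast; ring
      have h1 := hu.evi (u s) hz.1 _ _ hr hr'
      rw [e] at h1
      have h2 := hz.2 _ (hu.mem _ (hr.trans_lt hr'))
      set x := u (s + (k + 1 : ℕ) * η) - u s
      have h3 : -(‖z‖ * ‖x‖) ≤ inner ℝ z x := (abs_le.1 (abs_real_inner_le_norm z x)).1
      set a := η * ‖z‖ with ha
      have ha0 : 0 ≤ a := by positivity
      have h4 : (‖x‖ - a) ^ 2 ≤ a ^ 2 + (a * (k + 2 * √k)) ^ 2 := by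
        have h5 : ‖u (s + k * η) - u s‖ ^ 2 ≤ (a * (k + 2 * √k)) ^ 2 := by gcongr
        have h6 := mul_le_mul_of_nonneg_left (by linarith : f (u s) -
          f (u (s + (k + 1 : ℕ) * η)) ≤ ‖z‖ * ‖x‖) (by positivity : 0 ≤ 2 * η)
        simp only [ha] at *
        linarith
      have h7 : a ^ 2 + (a * (k + 2 * √k)) ^ 2 ≤ (a * (k + 2 * √(k + 1))) ^ 2 := by
        have h8 : √(k : ℝ) ≤ √(k + 1) := Real.sqrt_le_sqrt (by linarith)
        have h9 := Real.sq_sqrt (by positivity : (0 : ℝ) ≤ k)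
        have h10 := Real.sq_sqrt (by positivity : (0 : ℝ) ≤ (k : ℝ) + 1)
        have h11 : 1 + (k + 2 * √(k : ℝ)) ^ 2 ≤ (k + 2 * √((k : ℝ) + 1)) ^ 2 := by
          have := mul_le_mul_of_nonneg_left h8 (by positivity : (0 : ℝ) ≤ k)
          linarith
        have := mul_le_mul_of_nonneg_left h11 (sq_nonneg a)
        linarith
      have h12 := abs_le_of_sq_le_sq (h4.trans h7) (by positivity)
      push_cast
      linarith [(abs_le.1 h12).2]
  have hlim : Tendsto (fun M : ℕ => h * ‖z‖ * (1 + 2 * (1 / ((M : ℝ) + 1)))) atTop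
      (𝓝 (h * ‖z‖ * (1 + 2 * 0))) :=
    ((tendsto_one_div_add_atTop_nhds_zero_nat.const_mul 2).const_add 1).const_mul _
  refine (ge_of_tendsto hlim (Eventually.of_forall fun M => ?_)).trans (by simp)
  -- A square number of steps makes the root explicit: the relative error is `2 / (M + 1)`.
  have h1 := hstep (h / ((M : ℝ) + 1) ^ 2) (by positivity) ((M + 1) ^ 2)
  push_cast at h1
  rw [mul_div_cancel₀ _ (by positivity), Real.sqrt_sq (by positivity)] at h1
  refine h1.trans (le_of_eq ?_)
  field_simp

/-- Wherever the subdifferential is nonempty, the flow has a right derivative, the opposite of the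
shortest subgradient. -/
theorem ConvexEnergy.hasDerivWithinAt [CompleteSpace H] (hf : ConvexEnergy D f)
    (hu : IsEVI D f u) {t : ℝ} (ht : 0 ≤ t) {z : H} (hz : IsMinSubgrad D f (u t) z) :
    HasDerivWithinAt u (-z) (Ioi t) t := by
  rw [hasDerivWithinAt_iff_tendsto_slope' (s := Ioi t) (by simp)]
  have hl : Tendsto (fun r => r - t) (𝓝[>] t) (𝓝[>] 0) := by
    refine tendsto_nhdsWithin_iff.2 ⟨?_, ?_⟩
    · have : Tendsto (fun r => r - t) (𝓝 t) (𝓝 (t - t)) :=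
        Continuous.tendsto (by fun_prop) t
      rw [sub_self] at this
      exact this.mono_left nhdsWithin_le_nhds
    · filter_upwards [self_mem_nhdsWithin] with r hr using sub_pos.2 (mem_Ioi.1 hr)
  have e : ∀ r, t + (r - t) = r := fun r => by ring
  -- The negative slopes are approximate subgradients no longer than `z`, so they converge strongly.
  have := hz.tendsto (v := fun r => -((r - t)⁻¹ • (u (t + (r - t)) - u t))) (l := 𝓝[>] t) (by
      filter_upwards [self_mem_nhdsWithin] with r hr
      have hr : 0 < r - t := sub_pos.2 hr
      have := hu.norm_sub_le_of_subgrad ht hr.le hz.1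
      rw [norm_neg, norm_smul, norm_inv, Real.norm_of_nonneg hr.le, inv_mul_le_iff₀ hr]
      exact this) fun w hw ε hε => hf.eventually_approx_subgrad hu ht hl hw hε
  refine this.neg.congr fun r => ?_
  rw [neg_neg, e, slope_def_module]

/-- The right derivative. -/
noncomputable def rightDeriv (u : ℝ → H) (t : ℝ) : H := derivWithin u (Ici t) t

/-- Adding the endpoint to `Ioi t` does not affect the derivative. The `Ici` form is the one for
which `aestronglyMeasurable_derivWithin_Ici` gives measurability. -/
theorem ConvexEnergy.rightDeriv_eq [CompleteSpace H] (hf : ConvexEnergy D f)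
    (hu : IsEVI D f u) {t : ℝ} (ht : 0 ≤ t) {z : H} (hz : IsMinSubgrad D f (u t) z) :
    rightDeriv u t = -z :=
  (hf.hasDerivWithinAt hu ht hz).Ici_of_Ioi.derivWithin (uniqueDiffWithinAt_Ici t)

theorem ConvexEnergy.isMinSubgrad_neg_rightDeriv [CompleteSpace H] (hf : ConvexEnergy D f)
    (hu : IsEVI D f u) {t : ℝ} (ht : 0 < t) : IsMinSubgrad D f (u t) (-rightDeriv u t) := by
  obtain ⟨z, hz⟩ := exists_minimal_subgrad (hf.subgrad_nonempty hu ht)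
  rwa [hf.rightDeriv_eq hu ht.le hz, neg_neg]

theorem ConvexEnergy.hasDerivWithinAt_rightDeriv [CompleteSpace H] (hf : ConvexEnergy D f)
    (hu : IsEVI D f u) {t : ℝ} (ht : 0 < t) :
    HasDerivWithinAt u (rightDeriv u t) (Ioi t) t := by
  simpa using hf.hasDerivWithinAt hu ht.le (hf.isMinSubgrad_neg_rightDeriv hu ht)

/-- Increments at time `t` are bounded by increments at the earlier time `s`, and those by `h ‖z‖`.
Allowing `s = 0` gives the global bound for initial data in the domain of the subdifferential. -/
theorem ConvexEnergy.norm_rightDeriv_le [CompleteSpace H] (hf : ConvexEnergy D f)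
    (hu : IsEVI D f u) {s t : ℝ} (hs : 0 ≤ s) (ht : 0 < t) (hst : s ≤ t) {z : H}
    (hz : z ∈ subgrad D f (u s)) : ‖rightDeriv u t‖ ≤ ‖z‖ := by
  have h1 := (hasDerivWithinAt_iff_tendsto_slope' (s := Ioi t) (by simp)).1
    (hf.hasDerivWithinAt_rightDeriv hu ht)
  refine le_of_tendsto h1.norm ?_
  filter_upwards [self_mem_nhdsWithin] with r hr
  have hr : 0 < r - t := sub_pos.2 hr
  have h2 := (hu.norm_increment_le hs hst hr.le).trans (hu.norm_sub_le_of_subgrad hs hr.le hz)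
  rw [add_sub_cancel] at h2
  rw [slope_def_module, norm_smul, norm_inv, Real.norm_of_nonneg hr.le, inv_mul_le_iff₀ hr]
  exact h2

theorem ConvexEnergy.antitoneOn_norm_rightDeriv [CompleteSpace H] (hf : ConvexEnergy D f)
    (hu : IsEVI D f u) : AntitoneOn (fun t => ‖rightDeriv u t‖) (Ioi 0) := fun s hs t ht hst => by
  simpa using hf.norm_rightDeriv_le hu (le_of_lt hs) ht hst (hf.isMinSubgrad_neg_rightDeriv hu hs).1

/-- The velocity is continuous from the right. -/
theorem ConvexEnergy.tendsto_rightDeriv [CompleteSpace H] (hf : ConvexEnergy D f)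
    (hu : IsEVI D f u) {t : ℝ} (ht : 0 < t) :
    Tendsto (rightDeriv u) (𝓝[>] t) (𝓝 (rightDeriv u t)) := by
  have hz := hf.isMinSubgrad_neg_rightDeriv hu ht
  have hR : ∀ r ∈ Ioi t, ‖rightDeriv u r‖ ≤ ‖rightDeriv u t‖ := fun r hr =>
    hf.antitoneOn_norm_rightDeriv hu ht (ht.trans hr) (le_of_lt hr)
  have hcont : Tendsto u (𝓝[>] t) (𝓝 (u t)) :=
    ((hu.continuousOn t ht.le).mono fun r hr => ht.le.trans (le_of_lt hr)).tendsto
  have := hz.tendsto (v := fun r => -rightDeriv u r) (l := 𝓝[>] t) (by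
      filter_upwards [self_mem_nhdsWithin] with r hr
      simpa using hR r hr) fun w hw ε hε => by
    have h1 := hf.eventually_lt hcont (by
      filter_upwards [self_mem_nhdsWithin] with r hr using hu.mem r (ht.trans hr))
      (sub_lt_self (f (u t)) (half_pos hε))
    have h2 : Tendsto (fun r => ‖rightDeriv u t‖ * ‖u r - u t‖) (𝓝[>] t)
        (𝓝 (‖rightDeriv u t‖ * ‖u t - u t‖)) := (hcont.sub_const _).norm.const_mul _
    rw [sub_self, norm_zero, mul_zero] at h2
    filter_upwards [h1, h2.eventually (gt_mem_nhds (half_pos hε)), self_mem_nhdsWithin]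
      with r h1 h2 hr
    have h3 := (hf.isMinSubgrad_neg_rightDeriv hu (ht.trans hr)).1.2 w hw
    -- A subgradient at `u r` is an approximate subgradient at `u t`. The error is the product of
    -- the bounded speed and `‖u r - u t‖`, plus a loss from lower semicontinuity.
    have h4 : w - u t = (w - u r) + (u r - u t) := by abel
    have h5 := (le_abs_self _).trans (abs_real_inner_le_norm (-rightDeriv u r) (u r - u t))
    rw [norm_neg] at h5
    have h6 := mul_le_mul_of_nonneg_right (hR r hr) (norm_nonneg (u r - u t))
    rw [h4, inner_add_right]
    linarith
  simpa using this.neg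

/-- Along the flow after time `δ` there are subgradients of norm at most the speed at `δ`, so there
`f` is Lipschitz with that constant. -/
theorem ConvexEnergy.energy_sub_le [CompleteSpace H] (hf : ConvexEnergy D f)
    (hu : IsEVI D f u) {δ s t : ℝ} (hδ : 0 < δ) (hs : δ ≤ s) (ht : δ ≤ t) :
    f (u s) - f (u t) ≤ ‖rightDeriv u δ‖ * ‖u s - u t‖ := by
  have h1 := (hf.isMinSubgrad_neg_rightDeriv hu (hδ.trans_le hs)).1.2 _ (hu.mem t (hδ.trans_le ht))
  have h2 := (abs_le.1 (abs_real_inner_le_norm (-rightDeriv u s) (u t - u s))).1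
  rw [norm_neg, norm_sub_rev] at h2
  have h3 := mul_le_mul_of_nonneg_right (hf.antitoneOn_norm_rightDeriv hu hδ (hδ.trans_le hs) hs)
    (norm_nonneg (u s - u t))
  simp only at h3
  linarith

theorem ConvexEnergy.continuousOn_energy [CompleteSpace H] (hf : ConvexEnergy D f)
    (hu : IsEVI D f u) : ContinuousOn (fun t => f (u t)) (Ioi 0) := by
  intro t ht
  have ht : 0 < t := ht
  have hcont : Tendsto u (𝓝 t) (𝓝 (u t)) := (hu.continuousOn t ht.le).continuousAt (Ici_mem_nhds ht)
  refine ContinuousAt.continuousWithinAt ?_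
  refine tendsto_iff_norm_sub_tendsto_zero.2 ?_
  have h2 : Tendsto (fun r => ‖rightDeriv u (t / 2)‖ * ‖u r - u t‖) (𝓝 t)
      (𝓝 (‖rightDeriv u (t / 2)‖ * ‖u t - u t‖)) := (hcont.sub_const _).norm.const_mul _
  rw [sub_self, norm_zero, mul_zero] at h2
  refine squeeze_zero' (Eventually.of_forall fun _ => norm_nonneg _) ?_ h2
  filter_upwards [Ici_mem_nhds (half_lt_self ht)] with r hr
  rw [Real.norm_eq_abs, abs_le]
  have h3 := hf.energy_sub_le hu (half_pos ht) hr (half_le_self ht.le)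
  have h4 := hf.energy_sub_le hu (half_pos ht) (half_le_self ht.le) hr
  rw [norm_sub_rev] at h4
  constructor <;> linarith

/-- The energy identity. -/
theorem ConvexEnergy.hasDerivWithinAt_energy [CompleteSpace H] (hf : ConvexEnergy D f)
    (hu : IsEVI D f u) {t : ℝ} (ht : 0 < t) :
    HasDerivWithinAt (fun t => f (u t)) (-‖rightDeriv u t‖ ^ 2) (Ioi t) t := by
  rw [hasDerivWithinAt_iff_tendsto_slope' (s := Ioi t) (by simp)]
  have h1 := (hasDerivWithinAt_iff_tendsto_slope' (s := Ioi t) (by simp)).1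
    (hf.hasDerivWithinAt_rightDeriv hu ht)
  have e : -‖rightDeriv u t‖ ^ 2 = inner ℝ (-rightDeriv u t) (rightDeriv u t) := by
    rw [inner_neg_left, real_inner_self_eq_norm_sq]
  rw [e]
  -- The subgradient inequality at `t` bounds the slope of the energy from below, and the one at `r
  -- > t` bounds it from above. Right continuity of the velocity gives both bounds the same limit.
  refine tendsto_of_tendsto_of_tendsto_of_le_of_le' (tendsto_const_nhds.inner h1)
    ((hf.tendsto_rightDeriv hu ht).neg.inner h1) ?_ ?_
  all_goals
    filter_upwards [self_mem_nhdsWithin] with r hr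
    have hr' : 0 < r - t := sub_pos.2 hr
    rw [slope_def_module, slope_def_module, inner_smul_right, smul_eq_mul, inv_mul_eq_div,
      inv_mul_eq_div]
    refine (div_le_div_iff_of_pos_right hr').2 ?_
  · have := (hf.isMinSubgrad_neg_rightDeriv hu ht).1.2 _ (hu.mem r (ht.trans hr))
    linarith
  · have := (hf.isMinSubgrad_neg_rightDeriv hu (ht.trans hr)).1.2 _ (hu.mem t ht)
    rw [← neg_sub (u r), inner_neg_right] at this
    linarith

end Derivative

/-! ### Weak derivatives in time -/

section WeakDerivative

variable {E : Type*} [NormedAddCommGroup E] [NormedSpace ℝ E]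

/-- A continuous function with a locally integrable right derivative has it as weak derivative. -/
theorem hasWeakDerivOn_of_hasDerivWithinAt [CompleteSpace E] {J : Set ℝ} (hJ : IsOpen J)
    (hJc : J.OrdConnected) {g g' : ℝ → E} (hg : ContinuousOn g J)
    (hd : ∀ t ∈ J, HasDerivWithinAt g (g' t) (Ioi t) t) (hi : LocallyIntegrableOn g' J) :
    HasWeakDerivOn J g g' := by
  refine ⟨hg.locallyIntegrableOn hJ.measurableSet, hi, fun φ hφ => ?_⟩
  rcases (tsupport φ).eq_empty_or_nonempty with h0 | hne
  · have : φ = 0 := tsupport_eq_empty_iff.1 h0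
    subst this
    simp
  have hK : IsCompact (tsupport φ) := hφ.2.1
  -- Choose `[a, b] ⊆ J` with the support of `φ` in its interior. The fundamental theorem for right
  -- derivatives, applied to `φ • g` on `[a, b]`, then has no boundary terms.
  obtain ⟨l, hl, hlJ⟩ := exists_Ioc_subset_of_mem_nhds
    (hJ.mem_nhds (hφ.2.2 (hK.sInf_mem hne))) (exists_lt _)
  obtain ⟨r, hr, hrJ⟩ := exists_Ico_subset_of_mem_nhds
    (hJ.mem_nhds (hφ.2.2 (hK.sSup_mem hne))) (exists_gt _)
  obtain ⟨a, hla, ha⟩ := exists_between hl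
  obtain ⟨b, hb, hbr⟩ := exists_between hr
  have hsub : tsupport φ ⊆ Ioo a b := fun x hx =>
    ⟨ha.trans_le (csInf_le hK.bddBelow hx), (le_csSup hK.bddAbove hx).trans_lt hb⟩
  have hab : a ≤ b := by
    obtain ⟨x, hx⟩ := hne
    exact ((hsub hx).1.trans (hsub hx).2).le
  have hIcc : Icc a b ⊆ J := hJc.out (hlJ ⟨hla, ha.le⟩) (hrJ ⟨hb.le, hbr⟩)
  have hφa : φ a = 0 := image_eq_zero_of_notMem_tsupport fun h => lt_irrefl _ (hsub h).1
  have hφb : φ b = 0 := image_eq_zero_of_notMem_tsupport fun h => lt_irrefl _ (hsub h).2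
  have hdφ : Differentiable ℝ φ := hφ.1.differentiable (by simp)
  have hdc : Continuous (deriv φ) := hφ.1.continuous_deriv (by simp)
  have hint1 : IntervalIntegrable (fun t => φ t • g' t) volume a b := by
    refine IntervalIntegrable.continuousOn_smul ?_ hφ.1.continuous.continuousOn
    exact (intervalIntegrable_iff_integrableOn_Icc_of_le hab).2
      (hi.integrableOn_compact_subset hIcc isCompact_Icc)
  have hint2 : IntervalIntegrable (fun t => deriv φ t • g t) volume a b :=
    (hdc.continuousOn.smul (hg.mono hIcc)).intervalIntegrable_of_Icc hab
  have hftc := intervalIntegral.integral_eq_sub_of_hasDeriv_right_of_le hab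
    (f := fun t => φ t • g t) (f' := fun t => φ t • g' t + deriv φ t • g t)
    (hφ.1.continuous.continuousOn.smul (hg.mono hIcc))
    (fun x hx => (hdφ x).hasDerivAt.hasDerivWithinAt.smul (hd x (hIcc (Ioo_subset_Icc_self hx))))
    (hint1.add hint2)
  rw [intervalIntegral.integral_add hint1 hint2, hφa, hφb, zero_smul, zero_smul, sub_zero] at hftc
  have hred : ∀ F : ℝ → E, (∀ t, t ∉ tsupport φ → F t = 0) →
      ∫ t in J, F t = ∫ t in a..b, F t := fun F hF => by
    rw [intervalIntegral.integral_of_le hab]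
    refine (setIntegral_eq_of_subset_of_forall_sdiff_eq_zero hJ.measurableSet
      (Ioc_subset_Icc_self.trans hIcc) fun t ht => hF t fun h => ht.2 ?_)
    exact Ioo_subset_Ioc_self (hsub h)
  rw [hred _ fun t ht => by rw [image_eq_zero_of_notMem_tsupport fun h =>
      ht (tsupport_deriv_subset h), zero_smul],
    hred _ fun t ht => by rw [image_eq_zero_of_notMem_tsupport ht, zero_smul]]
  exact eq_neg_of_add_eq_zero_right hftc

/-- A smooth step from `0` to `1` on `[s, s + ε]`. -/
noncomputable def smoothStep (s ε r : ℝ) : ℝ := Real.smoothTransition ((r - s) / ε)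

theorem contDiff_smoothStep (s ε : ℝ) : ContDiff ℝ ∞ (smoothStep s ε) :=
  Real.smoothTransition.contDiff.comp (by fun_prop)

theorem smoothStep_of_le {s ε r : ℝ} (hε : 0 < ε) (h : r ≤ s) : smoothStep s ε r = 0 :=
  Real.smoothTransition.zero_of_nonpos (div_nonpos_of_nonpos_of_nonneg (sub_nonpos.2 h) hε.le)

theorem smoothStep_of_ge {s ε r : ℝ} (hε : 0 < ε) (h : s + ε ≤ r) : smoothStep s ε r = 1 :=
  Real.smoothTransition.one_of_one_le ((one_le_div hε).2 (by linarith))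

theorem monotone_smoothStep {s ε : ℝ} (hε : 0 < ε) : Monotone (smoothStep s ε) := fun _ _ hab =>
  Real.smoothTransition.monotone (div_le_div_of_nonneg_right (sub_le_sub_right hab s) hε.le)

theorem deriv_smoothStep_eq_zero {s ε r : ℝ} (hε : 0 < ε) (h : r ∉ Icc s (s + ε)) :
    deriv (smoothStep s ε) r = 0 := by
  rw [mem_Icc, not_and_or, not_le, not_le] at h
  rcases h with h | h
  · have : smoothStep s ε =ᶠ[𝓝 r] fun _ => 0 := by
      filter_upwards [Iio_mem_nhds h] with x hx using smoothStep_of_le hε (le_of_lt hx)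
    rw [this.deriv_eq, deriv_const]
  · have : smoothStep s ε =ᶠ[𝓝 r] fun _ => 1 := by
      filter_upwards [Ioi_mem_nhds h] with x hx using smoothStep_of_ge hε (le_of_lt hx)
    rw [this.deriv_eq, deriv_const]

theorem integral_deriv_smoothStep {s ε : ℝ} (hε : 0 < ε) :
    ∫ r in s..s + ε, deriv (smoothStep s ε) r = 1 := by
  rw [intervalIntegral.integral_deriv_eq_sub
    (fun x _ => ((contDiff_smoothStep s ε).differentiable (by simp)) x)
    (((contDiff_smoothStep s ε).continuous_deriv (by simp)).intervalIntegrable _ _),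
    smoothStep_of_ge hε le_rfl, smoothStep_of_le hε le_rfl, sub_zero]

/-- The derivatives of the steps are nonnegative, have mass one and concentrate at `s`: they form an
approximate identity. -/
theorem tendsto_integral_deriv_smoothStep [CompleteSpace E] {u : ℝ → E}
    (hu : ContinuousOn u (Ioi 0)) {s : ℝ} (hs : 0 < s) :
    Tendsto (fun k : ℕ => ∫ r in Ioi 0, deriv (smoothStep s (1 / ((k : ℝ) + 1))) r • u r) atTop
      (𝓝 (u s)) := by
  rw [Metric.tendsto_nhds]
  intro η hη
  have hcont : ContinuousAt u s := hu.continuousAt (Ioi_mem_nhds hs)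
  obtain ⟨δ, hδ, hclose⟩ := Metric.continuousAt_iff.1 hcont (η / 2) (half_pos hη)
  filter_upwards [tendsto_one_div_add_atTop_nhds_zero_nat.eventually (gt_mem_nhds hδ)] with k hk
  have hε : 0 < 1 / ((k : ℝ) + 1) := by positivity
  set ε := 1 / ((k : ℝ) + 1)
  have hle : s ≤ s + ε := by linarith
  have hsub : Icc s (s + ε) ⊆ Ioi 0 := fun r hr => hs.trans_le hr.1
  have hdc : Continuous (deriv (smoothStep s ε)) :=
    (contDiff_smoothStep s ε).continuous_deriv (by simp)
  have h1 : ∫ r in Ioi 0, deriv (smoothStep s ε) r • u r =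
      ∫ r in s..s + ε, deriv (smoothStep s ε) r • u r := by
    rw [intervalIntegral.integral_of_le hle, ← integral_Icc_eq_integral_Ioc]
    exact setIntegral_eq_of_subset_of_forall_sdiff_eq_zero measurableSet_Ioi hsub fun r hr => by
      rw [deriv_smoothStep_eq_zero hε hr.2, zero_smul]
  have h2 : ∫ r in s..s + ε, deriv (smoothStep s ε) r • u r - deriv (smoothStep s ε) r • u s =
      (∫ r in s..s + ε, deriv (smoothStep s ε) r • u r) - u s := by
    have i1 : IntervalIntegrable (fun r => deriv (smoothStep s ε) r • u r) volume s (s + ε) :=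
      (hdc.continuousOn.smul (hu.mono hsub)).intervalIntegrable_of_Icc hle
    have i2 : IntervalIntegrable (fun r => deriv (smoothStep s ε) r • u s) volume s (s + ε) :=
      (hdc.smul continuous_const).intervalIntegrable _ _
    rw [intervalIntegral.integral_sub i1 i2,
      intervalIntegral.integral_smul_const, integral_deriv_smoothStep hε, one_smul]
  rw [h1, dist_eq_norm, ← h2]
  refine lt_of_le_of_lt (intervalIntegral.norm_integral_le_of_norm_le hle
    (g := fun r => deriv (smoothStep s ε) r * (η / 2)) (Eventually.of_forall fun r hr => ?_)
    ((hdc.mul continuous_const).intervalIntegrable _ _)) ?_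
  · have hnn : 0 ≤ deriv (smoothStep s ε) r := (monotone_smoothStep hε).deriv_nonneg
    rw [← smul_sub, norm_smul, Real.norm_of_nonneg hnn, ← dist_eq_norm]
    refine mul_le_mul_of_nonneg_left (hclose ?_).le hnn
    rw [Real.dist_eq, abs_of_nonneg (by linarith [hr.1])]
    linarith [hr.2]
  · rw [intervalIntegral.integral_mul_const, integral_deriv_smoothStep hε, one_mul]
    exact half_lt_self hη

/-- A continuous function is a primitive of its weak derivative. -/
theorem HasWeakDerivOn.sub_eq_integral [CompleteSpace E] {u v : ℝ → E}
    (h : HasWeakDerivOn (Ioi 0) u v) (hu : ContinuousOn u (Ioi 0)) {s t : ℝ} (hs : 0 < s)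
    (hst : s ≤ t) : u t - u s = ∫ r in s..t, v r := by
  have ht : 0 < t := hs.trans_le hst
  set ε : ℕ → ℝ := fun k => 1 / ((k : ℝ) + 1) with hε
  have hε0 : ∀ k, 0 < ε k := fun k => by positivity
  have hε1 : ∀ k, ε k ≤ 1 := fun k => by
    simp only [hε]
    rw [div_le_one (by positivity)]
    have : (0 : ℝ) ≤ k := by positivity
    linarith
  -- These test functions tend pointwise to the indicator of `(s, t]`, while their derivatives tend
  -- to a unit mass at `s` minus one at `t`. The bound `ε k ≤ 1` keeps all supports in `[s, t + 1]`.
  set φ : ℕ → ℝ → ℝ := fun k r => smoothStep s (ε k) r - smoothStep t (ε k) r with hφ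
  have hφsm : ∀ k, ContDiff ℝ ∞ (φ k) := fun k =>
    (contDiff_smoothStep _ _).sub (contDiff_smoothStep _ _)
  have hsupp : ∀ k, tsupport (φ k) ⊆ Icc s (t + 1) := fun k => by
    refine closure_minimal (fun r hr => ?_) isClosed_Icc
    by_contra hcon
    refine hr ?_
    rw [mem_Icc, not_and_or, not_le, not_le] at hcon
    simp only [hφ]
    rcases hcon with h | h
    · rw [smoothStep_of_le (hε0 k) h.le, smoothStep_of_le (hε0 k) (h.le.trans hst), sub_zero]
    · rw [smoothStep_of_ge (hε0 k) (by linarith [hε1 k]),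
        smoothStep_of_ge (hε0 k) (by linarith [hε1 k]), sub_self]
  have hpos : Icc s (t + 1) ⊆ Ioi 0 := fun r hr => hs.trans_le hr.1
  have htest : ∀ k, IsTest (Ioi 0) (φ k) := fun k =>
    ⟨hφsm k, isCompact_Icc.of_isClosed_subset (isClosed_tsupport _) (hsupp k),
      (hsupp k).trans hpos⟩
  have hdint : ∀ a : ℝ, 0 < a → ∀ k, Integrable (fun r => deriv (smoothStep a (ε k)) r • u r)
      (volume.restrict (Ioi 0)) := fun a ha k => by
    have hsub : Icc a (a + ε k) ⊆ Ioi 0 := fun r hr => ha.trans_le hr.1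
    have h1 : IntegrableOn (fun r => deriv (smoothStep a (ε k)) r • u r) (Icc a (a + ε k)) :=
      ((((contDiff_smoothStep a (ε k)).continuous_deriv (by simp)).continuousOn.smul
        (hu.mono hsub))).integrableOn_Icc
    exact (h1.of_forall_sdiff_eq_zero measurableSet_Ioi fun r hr => by
      rw [deriv_smoothStep_eq_zero (hε0 k) hr.2, zero_smul])
  have hL : Tendsto (fun k => ∫ r in Ioi 0, deriv (φ k) r • u r) atTop (𝓝 (u s - u t)) := by
    refine ((tendsto_integral_deriv_smoothStep hu hs).sub
      (tendsto_integral_deriv_smoothStep hu ht)).congr fun k => ?_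
    rw [← integral_sub (hdint s hs k) (hdint t ht k)]
    congr 1
    ext r
    rw [← sub_smul]
    congr 1
    exact (deriv_fun_sub ((contDiff_smoothStep s (ε k)).differentiable (by simp) r)
      ((contDiff_smoothStep t (ε k)).differentiable (by simp) r)).symm
  have hvint : IntegrableOn v (Icc s (t + 1)) :=
    h.2.1.integrableOn_compact_subset hpos isCompact_Icc
  have hvI : Integrable ((Icc s (t + 1)).indicator v) (volume.restrict (Ioi 0)) :=
    ((integrable_indicator_iff measurableSet_Icc).2 hvint).restrict
  have hφbd : ∀ k r, ‖φ k r‖ ≤ 1 := fun k r => by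
    simp only [hφ]
    rw [Real.norm_eq_abs, abs_le]
    have h1 := Real.smoothTransition.nonneg ((r - s) / ε k)
    have h2 := Real.smoothTransition.le_one ((r - s) / ε k)
    have h3 := Real.smoothTransition.nonneg ((r - t) / ε k)
    have h4 := Real.smoothTransition.le_one ((r - t) / ε k)
    unfold smoothStep
    constructor <;> linarith
  have hφv : ∀ k r, φ k r • v r = φ k r • (Icc s (t + 1)).indicator v r := fun k r => by
    by_cases hr : r ∈ Icc s (t + 1)
    · rw [indicator_of_mem hr]
    · rw [image_eq_zero_of_notMem_tsupport fun h => hr (hsupp k h), zero_smul, zero_smul]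
  have hR : Tendsto (fun k => ∫ r in Ioi 0, φ k r • v r) atTop
      (𝓝 (∫ r in Ioi 0, (Ioc s t).indicator v r)) := by
    refine tendsto_integral_of_dominated_convergence
      (fun r => ‖(Icc s (t + 1)).indicator v r‖) (fun k => ?_) hvI.norm (fun k => ?_) ?_
    · simp only [hφv]
      exact (hφsm k).continuous.aestronglyMeasurable.smul hvI.aestronglyMeasurable
    · refine Eventually.of_forall fun r => ?_
      rw [hφv, norm_smul]
      exact mul_le_of_le_one_left (norm_nonneg _) (hφbd k r)
    · refine Eventually.of_forall fun r => tendsto_nhds_of_eventually_eq ?_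
      have hlt : ∀ a : ℝ, a < r → ∀ᶠ k in atTop, smoothStep a (ε k) r = 1 := fun a ha => by
        filter_upwards [tendsto_one_div_add_atTop_nhds_zero_nat.eventually
          (gt_mem_nhds (sub_pos.2 ha))] with k hk
        exact smoothStep_of_ge (hε0 k) (by simp only [hε]; linarith)
      by_cases hr : r ∈ Ioc s t
      · filter_upwards [hlt s hr.1] with k hk
        simp only [hφ]
        rw [hk, smoothStep_of_le (hε0 k) hr.2, sub_zero, one_smul, indicator_of_mem hr]
      · rw [indicator_of_notMem hr]
        rw [mem_Ioc, not_and_or, not_lt, not_le] at hr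
        rcases hr with hr | hr
        · refine Eventually.of_forall fun k => ?_
          simp only [hφ]
          rw [smoothStep_of_le (hε0 k) hr, smoothStep_of_le (hε0 k) (hr.trans hst), sub_zero,
            zero_smul]
        · filter_upwards [hlt s (hst.trans_lt hr), hlt t hr] with k h1 h2
          simp only [hφ]
          rw [h1, h2, sub_self, zero_smul]
  have heq := tendsto_nhds_unique hL (hR.neg.congr fun k => (h.2.2 _ (htest k)).symm)
  rw [setIntegral_indicator measurableSet_Ioc, inter_eq_right.2 (show Ioc s t ⊆ Ioi 0 from fun r hr => hs.trans hr.1),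
    ← intervalIntegral.integral_of_le hst] at heq
  rw [← neg_sub, heq, neg_neg]

/-- A Hilbert-space-valued Lipschitz primitive `x` of `x'` with `⟪x, x'⟫ ≤ 0` has decreasing
norm. -/
theorem norm_le_of_inner_nonpos {H : Type*} [NormedAddCommGroup H] [InnerProductSpace ℝ H]
    [CompleteSpace H] {x x' : ℝ → H} {a b L : ℝ} (hab : a ≤ b)
    (hint : IntervalIntegrable x' volume a b) (hL : ∀ᵐ t, t ∈ Ioc a b → ‖x' t‖ ≤ L)
    (hx : ∀ s t, a ≤ s → s ≤ t → t ≤ b → x t - x s = ∫ r in s..t, x' r)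
    (hneg : ∀ᵐ t, t ∈ Ioc a b → inner ℝ (x t) (x' t) ≤ 0) : ‖x b‖ ≤ ‖x a‖ := by
  rcases hab.eq_or_lt with rfl | hlt
  · exact le_rfl
  have hL0 : 0 ≤ L := by
    have : ∃ᵐ t ∂(volume.restrict (Ioc a b)), True := by
      rw [frequently_true_iff_neBot, ae_neBot]
      simp [hlt]
    obtain ⟨t, -, ht⟩ := (this.and_eventually
      ((ae_restrict_iff' measurableSet_Ioc).2 hL)).exists
    exact (norm_nonneg _).trans ht
  have hlip : ∀ s t, a ≤ s → s ≤ t → t ≤ b → ‖x t - x s‖ ≤ L * (t - s) := by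
    intro s t hs hst ht
    rw [hx s t hs hst ht]
    have := intervalIntegral.norm_integral_le_of_norm_le (μ := volume) hst
      (f := x') (g := fun _ => L) (by
      filter_upwards [hL] with r hr hr' using hr ⟨hs.trans_lt hr'.1, hr'.2.trans ht⟩)
      intervalIntegrable_const
    simpa [mul_comm] using this
  set C := ‖x a‖ + L * (b - a) with hC
  have hC0 : 0 ≤ C := by
    have : 0 ≤ b - a := by linarith
    positivity
  have hbd : ∀ t ∈ Icc a b, ‖x t‖ ≤ C := fun t ht => by
    have h1 := hlip a t le_rfl ht.1 ht.2
    have h2 := norm_le_norm_add_norm_sub' (x t) (x a)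
    have h3 := mul_le_mul_of_nonneg_left (sub_le_sub_right ht.2 a) hL0
    linarith
  -- `‖x‖²` is Lipschitz, hence absolutely continuous, so the sign of its derivative almost
  -- everywhere decides monotonicity.
  have hac : AbsolutelyContinuousOnInterval (fun t => ‖x t‖ ^ 2) a b := by
    refine LipschitzOnWith.absolutelyContinuousOnInterval (K := Real.toNNReal (2 * C * L)) ?_
    rw [uIcc_of_le hab]
    refine LipschitzOnWith.of_dist_le_mul fun s hs t ht => ?_
    rw [Real.coe_toNNReal _ (by positivity), Real.dist_eq]
    have h1 : |‖x s‖ ^ 2 - ‖x t‖ ^ 2| ≤ 2 * C * ‖x s - x t‖ := by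
      rw [sq_sub_sq, abs_mul, abs_of_nonneg (by positivity)]
      have := abs_norm_sub_norm_le (x s) (x t)
      have := hbd s hs
      have := hbd t ht
      gcongr
      linarith
    refine h1.trans ?_
    rw [mul_assoc _ L]
    refine mul_le_mul_of_nonneg_left ?_ (by positivity)
    rw [Real.dist_eq]
    rcases le_total s t with h | h
    · rw [norm_sub_rev, abs_sub_comm, abs_of_nonneg (sub_nonneg.2 h)]
      exact hlip s t hs.1 h ht.2
    · rw [abs_of_nonneg (sub_nonneg.2 h)]
      exact hlip t s ht.1 h hs.2
  have hder : ∀ᵐ t, t ∈ Ioc a b → deriv (fun t => ‖x t‖ ^ 2) t ≤ 0 := by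
    have hb : ∀ᵐ t : ℝ, t ≠ b := by simp [ae_iff, measure_singleton]
    filter_upwards [hint.ae_hasDerivAt_integral, hneg, hb] with t h1 h2 hb ht
    have htI : t ∈ Icc a b := Ioc_subset_Icc_self ht
    have h3 := (h1 (by rwa [uIcc_of_le hab]) a left_mem_uIcc).const_add (x a)
    have h4 : HasDerivAt x (x' t) t := by
      refine h3.congr_of_eventuallyEq ?_
      filter_upwards [Ioo_mem_nhds ht.1 (lt_of_le_of_ne ht.2 hb)] with r hr
      rw [← hx a r le_rfl hr.1.le hr.2.le]
      abel
    rw [h4.norm_sq.deriv]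
    linarith [h2 ht]
  have h1 := hac.integral_deriv_eq_sub
  have h2 : ∫ t in a..b, deriv (fun t => ‖x t‖ ^ 2) t ≤ 0 := by
    rw [intervalIntegral.integral_of_le hab]
    exact setIntegral_nonpos_of_ae_restrict ((ae_restrict_iff' measurableSet_Ioc).2 hder)
  rw [h1] at h2
  exact (sq_le_sq₀ (norm_nonneg _) (norm_nonneg _)).1 (by linarith)

end WeakDerivative

/-! ### Integrability of velocity and energy, and uniqueness -/

section FlowRegularity

variable {H : Type*} [NormedAddCommGroup H] [InnerProductSpace ℝ H] [CompleteSpace H] {D : Set H}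
  {f : H → ℝ} {u : ℝ → H}

theorem ConvexEnergy.eLpNorm_rightDeriv_le (hf : ConvexEnergy D f) (hu : IsEVI D f u) {δ : ℝ}
    (hδ : 0 ≤ δ) {z : H} (hz : z ∈ subgrad D f (u δ)) :
    eLpNorm (rightDeriv u) ⊤ (volume.restrict (Ioi δ)) ≤ ‖z‖ₑ := by
  rw [eLpNorm_exponent_top]
  refine eLpNormEssSup_le_of_ae_enorm_bound ?_
  filter_upwards [ae_restrict_mem measurableSet_Ioi] with t ht
  exact enorm_le_iff_norm_le.2 (hf.norm_rightDeriv_le hu hδ (hδ.trans_lt ht) (le_of_lt ht) hz)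

theorem ConvexEnergy.memLp_top_rightDeriv (hf : ConvexEnergy D f) (hu : IsEVI D f u) {δ : ℝ}
    (hδ : 0 ≤ δ) (hne : (subgrad D f (u δ)).Nonempty) :
    MemLp (rightDeriv u) ⊤ (volume.restrict (Ioi δ)) := by
  obtain ⟨z, hz⟩ := hne
  exact ⟨aestronglyMeasurable_derivWithin_Ici u _,
    (hf.eLpNorm_rightDeriv_le hu hδ hz).trans_lt enorm_lt_top⟩

theorem locallyIntegrableOn_Ioi_of_memLp_top {E : Type*} [NormedAddCommGroup E] {g : ℝ → E}
    (hg : ∀ δ : ℝ, 0 < δ → MemLp g ⊤ (volume.restrict (Ioi δ))) :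
    LocallyIntegrableOn g (Ioi 0) := by
  intro t ht
  have ht : 0 < t := ht
  refine ⟨Ioo (t / 2) (t + 1), mem_nhdsWithin_of_mem_nhds
    (Ioo_mem_nhds (half_lt_self ht) (lt_add_one t)), ?_⟩
  exact ((hg (t / 2) (half_pos ht)).mono_measure
    (Measure.restrict_mono Ioo_subset_Ioi_self le_rfl)).integrable le_top

theorem ConvexEnergy.hasWeakDerivOn (hf : ConvexEnergy D f) (hu : IsEVI D f u) :
    HasWeakDerivOn (Ioi 0) u (rightDeriv u) :=
  hasWeakDerivOn_of_hasDerivWithinAt isOpen_Ioi ordConnected_Ioi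
    (hu.continuousOn.mono Ioi_subset_Ici_self) (fun _ ht => hf.hasDerivWithinAt_rightDeriv hu ht)
    (locallyIntegrableOn_Ioi_of_memLp_top fun _ hδ =>
      hf.memLp_top_rightDeriv hu hδ.le (hf.subgrad_nonempty hu hδ))

theorem integrableOn_Ioo_of_integral_norm_bounded {E : Type*} [NormedAddCommGroup E] {g : ℝ → E}
    {T I : ℝ} (hT : 0 < T) (hg : ∀ δ, 0 < δ → IntegrableOn g (Ioc δ T))
    (hI : ∀ δ, 0 < δ → δ ≤ T → ∫ t in δ..T, ‖g t‖ ≤ I) : IntegrableOn g (Ioo 0 T) := by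
  have hlim : Tendsto (fun k : ℕ => T * (1 / ((k : ℝ) + 1))) atTop (𝓝 0) := by
    simpa only [mul_zero] using tendsto_one_div_add_atTop_nhds_zero_nat.const_mul T
  have hpos : ∀ k : ℕ, 0 < T * (1 / ((k : ℝ) + 1)) := fun k => by positivity
  have hle : ∀ k : ℕ, T * (1 / ((k : ℝ) + 1)) ≤ T := fun k => by
    refine mul_le_of_le_one_right hT.le ?_
    rw [div_le_one (by positivity)]
    have : (0 : ℝ) ≤ k := by positivity
    linarith
  refine (integrableOn_Ioc_of_intervalIntegral_norm_bounded_left (I := I)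
    (fun k : ℕ => hg _ (hpos k)) hlim (Eventually.of_forall fun k => ?_)).mono_set
    Ioo_subset_Ioc_self
  rw [← intervalIntegral.integral_of_le (hle k)]
  exact hI _ (hpos k) (hle k)

/-- The energy is integrable up to time zero. -/
theorem ConvexEnergy.integrableOn_energy (hf : ConvexEnergy D f) (hu : IsEVI D f u) {T : ℝ}
    (hT : 0 < T) : IntegrableOn (fun t => f (u t)) (Ioo 0 T) := by
  obtain ⟨m, hm⟩ := hf.bddBelow
  obtain ⟨w, hw⟩ := hf.nonempty
  obtain ⟨C, hC⟩ := isCompact_Icc.bddAbove_image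
    (f := fun t => (1 / 2 : ℝ) * ‖u t - w‖ ^ 2) (K := Icc 0 T)
    ((((hu.continuousOn.mono Icc_subset_Ici_self).sub continuousOn_const).norm.pow 2).const_smul
      (1 / 2 : ℝ))
  have hC : ∀ t ∈ Icc 0 T, 1 / 2 * ‖u t - w‖ ^ 2 ≤ C := fun t ht => hC ⟨t, ht, rfl⟩
  have hcont : ∀ δ, 0 < δ → ContinuousOn (fun t => f (u t)) (Icc δ T) := fun δ hδ =>
    (hf.continuousOn_energy hu).mono fun t ht => hδ.trans_le ht.1
  refine integrableOn_Ioo_of_integral_norm_bounded hT (I := C + T * (|f w| + 2 * |m|))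
    (fun δ hδ => ((hcont δ hδ).integrableOn_Icc).mono_set Ioc_subset_Icc_self) fun δ hδ hδT => ?_
  have h1 : ∫ t in δ..T, f (u t) ≤ (T - δ) * f w + C := by
    have hφ : ContinuousOn (fun t => f w - f (u t)) (Icc δ T) := continuousOn_const.sub (hcont δ hδ)
    -- The subgradient inequality at `u t` reads `d/dt (½ ‖u - w‖²) ≤ f w - f u`. Its integral
    -- bounds `∫ f u` by quantities that stay finite as `δ → 0`.
    have := intervalIntegral.sub_le_integral_of_hasDeriv_right_of_le hδT
      (g := fun t => 1 / 2 * ‖u t - w‖ ^ 2)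
      (g' := fun t => 1 / 2 * (2 * inner ℝ (u t - w) (rightDeriv u t)))
      (φ := fun t => f w - f (u t))
      ((((hu.continuousOn.mono fun t ht => hδ.le.trans ht.1).sub continuousOn_const).norm.pow
        2).const_smul (1 / 2 : ℝ))
      (fun t ht => (((hf.hasDerivWithinAt_rightDeriv hu (hδ.trans ht.1)).sub_const
        w).norm_sq).const_mul (1 / 2))
      hφ.integrableOn_Icc fun t ht => by
        have h2 := (hf.isMinSubgrad_neg_rightDeriv hu (hδ.trans ht.1)).1.2 w hw
        rw [← neg_sub (u t), inner_neg_neg, real_inner_comm] at h2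
        linarith
    rw [intervalIntegral.integral_sub intervalIntegrable_const
      ((hcont δ hδ).intervalIntegrable_of_Icc hδT), intervalIntegral.integral_const,
      smul_eq_mul] at this
    have h3 := hC δ ⟨hδ.le, hδT⟩
    have h4 : 0 ≤ 1 / 2 * ‖u T - w‖ ^ 2 := by positivity
    linarith
  -- Since `f ≥ m ≥ -|m|` on `D`, one has `|f| ≤ f + 2 |m|`.
  have h2 : ∫ t in δ..T, ‖f (u t)‖ ≤ ∫ t in δ..T, (f (u t) + 2 * |m|) := by
    refine intervalIntegral.integral_mono_on hδT
      ((hcont δ hδ).norm.intervalIntegrable_of_Icc hδT)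
      (((hcont δ hδ).add continuousOn_const).intervalIntegrable_of_Icc hδT) fun t ht => ?_
    have := hm _ (hu.mem t (hδ.trans_le ht.1))
    have := neg_abs_le m
    rw [Real.norm_eq_abs, abs_le]
    constructor <;> linarith [abs_nonneg m]
  rw [intervalIntegral.integral_add ((hcont δ hδ).intervalIntegrable_of_Icc hδT)
    intervalIntegrable_const, intervalIntegral.integral_const, smul_eq_mul] at h2
  have h3 : (T - δ) * f w ≤ T * |f w| :=
    (mul_le_mul_of_nonneg_left (le_abs_self _) (by linarith)).trans
      (mul_le_mul_of_nonneg_right (by linarith) (abs_nonneg _))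
  have h4 : (T - δ) * (2 * |m|) ≤ T * (2 * |m|) :=
    mul_le_mul_of_nonneg_right (by linarith) (by positivity)
  linarith

/-- For initial data of finite energy, the velocity is square integrable up to time zero. -/
theorem ConvexEnergy.integrableOn_sq_rightDeriv (hf : ConvexEnergy D f) (hu : IsEVI D f u)
    (h0 : u 0 ∈ D) {T : ℝ} (hT : 0 < T) :
    IntegrableOn (fun t => ‖rightDeriv u t‖ ^ 2) (Ioo 0 T) := by
  obtain ⟨m, hm⟩ := hf.bddBelow
  have hmeas : AEStronglyMeasurable (fun t => ‖rightDeriv u t‖ ^ 2) volume :=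
    ((aestronglyMeasurable_derivWithin_Ici u _).norm.pow 2)
  have hint : ∀ δ, 0 < δ → IntegrableOn (fun t => ‖rightDeriv u t‖ ^ 2) (Icc δ T) := by
    intro δ hδ
    refine Measure.integrableOn_of_bounded (M := ‖rightDeriv u δ‖ ^ 2) (by simp) hmeas ?_
    filter_upwards [ae_restrict_mem measurableSet_Icc] with t ht
    have := hf.antitoneOn_norm_rightDeriv hu hδ (hδ.trans_le ht.1) ht.1
    rw [Real.norm_of_nonneg (by positivity)]
    simp only at this
    gcongr
  refine integrableOn_Ioo_of_integral_norm_bounded hT (I := f (u 0) - m)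
    (fun δ hδ => (hint δ hδ).mono_set Ioc_subset_Icc_self) fun δ hδ hδT => ?_
  -- The energy identity on `[δ, T]`. The dissipated energy is at most `f (u 0) - m`, uniformly in
  -- `δ`.
  have h1 := intervalIntegral.integral_eq_sub_of_hasDeriv_right_of_le hδT
    ((hf.continuousOn_energy hu).mono fun t ht => hδ.trans_le ht.1)
    (fun t ht => hf.hasDerivWithinAt_energy hu (hδ.trans ht.1))
    ((intervalIntegrable_iff_integrableOn_Icc_of_le hδT).2 (hint δ hδ).neg)
  rw [intervalIntegral.integral_neg] at h1
  have h2 := hu.energy_le le_rfl hδ.le h0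
  have h3 := hm _ (hu.mem T hT)
  simp only [norm_pow, norm_norm]
  linarith

theorem ConvexEnergy.memLp_two_rightDeriv (hf : ConvexEnergy D f) (hu : IsEVI D f u)
    (h0 : u 0 ∈ D) {T : ℝ} (hT : 0 < T) :
    MemLp (rightDeriv u) 2 (volume.restrict (Ioo 0 T)) :=
  (memLp_two_iff_integrable_sq_norm (aestronglyMeasurable_derivWithin_Ici u _)).2
    (hf.integrableOn_sq_rightDeriv hu h0 hT)

/-- For initial data of finite energy, the energy is a `W^{1,1}` function of time. -/
theorem ConvexEnergy.memW11_energy (hf : ConvexEnergy D f) (hu : IsEVI D f u)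
    (h0 : u 0 ∈ D) {T : ℝ} (hT : 0 < T) : MemW11 T fun t => f (u t) := by
  have hi := (hf.integrableOn_sq_rightDeriv hu h0 hT).neg
  refine ⟨hf.integrableOn_energy hu hT, fun t => -‖rightDeriv u t‖ ^ 2, hi,
    hasWeakDerivOn_of_hasDerivWithinAt isOpen_Ioo ordConnected_Ioo
      ((hf.continuousOn_energy hu).mono Ioo_subset_Ioi_self)
      (fun t ht => hf.hasDerivWithinAt_energy hu ht.1) hi.locallyIntegrableOn⟩

/-- Gradient flows in the weak sense approach each other. -/
theorem norm_sub_le_of_hasWeakDerivOn {u v du dv : ℝ → H}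
    (hu : ContinuousOn u (Ici 0)) (hv : ContinuousOn v (Ici 0))
    (hdu : HasWeakDerivOn (Ioi 0) u du) (hdv : HasWeakDerivOn (Ioi 0) v dv)
    (hbu : ∀ δ : ℝ, 0 < δ → MemLp du ⊤ (volume.restrict (Ioi δ)))
    (hbv : ∀ δ : ℝ, 0 < δ → MemLp dv ⊤ (volume.restrict (Ioi δ)))
    (hsu : ∀ᵐ t ∂(volume.restrict (Ioi (0 : ℝ))), -du t ∈ subgrad D f (u t))
    (hsv : ∀ᵐ t ∂(volume.restrict (Ioi (0 : ℝ))), -dv t ∈ subgrad D f (v t))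
    {t : ℝ} (ht : 0 ≤ t) : ‖u t - v t‖ ≤ ‖u 0 - v 0‖ := by
  have hpos : ∀ s, 0 < s → s ≤ t → ‖u t - v t‖ ≤ ‖u s - v s‖ := by
    intro s hs hst
    have hsub : ∀ a b : ℝ, 0 < a → Icc a b ⊆ Ioi 0 := fun a b ha r hr => ha.trans_le hr.1
    have hiu : ∀ a b, 0 < a → a ≤ b → IntervalIntegrable du volume a b := fun a b ha hab =>
      (intervalIntegrable_iff_integrableOn_Icc_of_le hab).2
        (hdu.2.1.integrableOn_compact_subset (hsub a b ha) isCompact_Icc)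
    have hiv : ∀ a b, 0 < a → a ≤ b → IntervalIntegrable dv volume a b := fun a b ha hab =>
      (intervalIntegrable_iff_integrableOn_Icc_of_le hab).2
        (hdv.2.1.integrableOn_compact_subset (hsub a b ha) isCompact_Icc)
    have hbd : ∃ L, ∀ᵐ r, r ∈ Ioc s t → ‖du r - dv r‖ ≤ L := by
      obtain ⟨L, hL⟩ := eLpNormEssSup_lt_top_iff_isBoundedUnder.1 (by
        have := ((hbu s hs).sub (hbv s hs)).2
        rwa [eLpNorm_exponent_top] at this)
      refine ⟨L, ?_⟩
      rw [eventually_map, ae_restrict_iff' measurableSet_Ioi] at hL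
      filter_upwards [hL] with r hr hrI
      exact_mod_cast hr hrI.1
    obtain ⟨L, hL⟩ := hbd
    refine norm_le_of_inner_nonpos (x := fun r => u r - v r) hst
      ((hiu s t hs hst).sub (hiv s t hs hst)) hL (fun a b ha hab hb => ?_) ?_
    · have ha := hs.trans_le ha
      rw [intervalIntegral.integral_sub (hiu a b ha hab) (hiv a b ha hab),
        ← hdu.sub_eq_integral (hu.mono Ioi_subset_Ici_self) ha hab,
        ← hdv.sub_eq_integral (hv.mono Ioi_subset_Ici_self) ha hab]
      abel
    · rw [ae_restrict_iff' measurableSet_Ioi] at hsu hsv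
      filter_upwards [hsu, hsv] with r h1 h2 hr
      have hr : r ∈ Ioi (0 : ℝ) := hs.trans hr.1
      -- Adding the two subgradient inequalities, each tested with the other solution, is the
      -- monotonicity of the subdifferential.
      have h3 := (h1 hr).2 _ (h2 hr).1
      have h4 := (h2 hr).2 _ (h1 hr).1
      rw [← neg_sub (u r), inner_neg_neg] at h3
      rw [inner_neg_left] at h4
      rw [inner_sub_right, real_inner_comm, real_inner_comm (dv r)]
      linarith
  rcases ht.eq_or_lt with rfl | ht
  · exact le_rfl
  have h1 : Tendsto (fun s => ‖u s - v s‖) (𝓝[>] 0) (𝓝 ‖u 0 - v 0‖) :=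
    (((hu 0 self_mem_Ici).mono Ioi_subset_Ici_self).sub
      ((hv 0 self_mem_Ici).mono Ioi_subset_Ici_self)).norm
  refine ge_of_tendsto h1 ?_
  filter_upwards [Ioo_mem_nhdsGT ht] with s hs using hpos s hs.1 hs.2.le

end FlowRegularity

/-! ### Uniform convexity of powers of the norm -/

section UniformConvexity

/-- The power `q` of the norm of `V` is uniformly convex on bounded sets. -/
def NormRpowUniformlyConvex (V : Type*) [NormedAddCommGroup V] [NormedSpace ℝ V] (q : ℝ) : Prop :=
  ∀ ε > 0, ∃ C ≥ 0, ∀ x y : V, ‖x - y‖ ^ q ≤ ε * (‖x‖ ^ q + ‖y‖ ^ q) +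
    C * ((‖x‖ ^ q + ‖y‖ ^ q) / 2 - ‖(1 / 2 : ℝ) • (x + y)‖ ^ q)

variable {V : Type*} [NormedAddCommGroup V] [NormedSpace ℝ V] {q : ℝ}

theorem norm_midpoint_rpow_le (hq : 1 ≤ q) (x y : V) :
    ‖(1 / 2 : ℝ) • (x + y)‖ ^ q ≤ (‖x‖ ^ q + ‖y‖ ^ q) / 2 := by
  have h1 : ‖(1 / 2 : ℝ) • (x + y)‖ ≤ 1 / 2 * ‖x‖ + 1 / 2 * ‖y‖ := by
    rw [norm_smul, Real.norm_of_nonneg (by norm_num), ← mul_add]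
    exact mul_le_mul_of_nonneg_left (norm_add_le x y) (by norm_num)
  have h2 := (convexOn_rpow hq).2 (norm_nonneg x) (norm_nonneg y)
    (by norm_num : (0 : ℝ) ≤ 1 / 2) (by norm_num : (0 : ℝ) ≤ 1 / 2) (by norm_num)
  simp only [smul_eq_mul] at h2
  have h3 := Real.rpow_le_rpow (norm_nonneg _) h1 (by linarith : 0 ≤ q)
  linarith

/-- If the norms agree, strict convexity of the space gives the gap. If they differ, strict
convexity of `t ↦ t ^ q` does. -/
theorem norm_midpoint_rpow_lt [StrictConvexSpace ℝ V] (hq : 1 < q) {x y : V} (hxy : x ≠ y) :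
    ‖(1 / 2 : ℝ) • (x + y)‖ ^ q < (‖x‖ ^ q + ‖y‖ ^ q) / 2 := by
  rcases eq_or_ne ‖x‖ ‖y‖ with h | h
  · have h1 := norm_combo_lt_of_ne le_rfl h.ge hxy (by norm_num : (0 : ℝ) < 1 / 2)
      (by norm_num : (0 : ℝ) < 1 / 2) (by norm_num)
    rw [← smul_add] at h1
    have := Real.rpow_lt_rpow (norm_nonneg _) h1 (by linarith : 0 < q)
    rw [← h]
    linarith
  · have h1 : ‖(1 / 2 : ℝ) • (x + y)‖ ≤ 1 / 2 * ‖x‖ + 1 / 2 * ‖y‖ := by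
      rw [norm_smul, Real.norm_of_nonneg (by norm_num), ← mul_add]
      exact mul_le_mul_of_nonneg_left (norm_add_le x y) (by norm_num)
    have h2 := (strictConvexOn_rpow hq).2 (norm_nonneg x) (norm_nonneg y) h
      (by norm_num : (0 : ℝ) < 1 / 2) (by norm_num : (0 : ℝ) < 1 / 2) (by norm_num)
    simp only [smul_eq_mul] at h2
    have h3 := Real.rpow_le_rpow (norm_nonneg _) h1 (by linarith : 0 ≤ q)
    linarith

/-- In a finite-dimensional strictly convex space powers of the norm are uniformly convex. -/
theorem normRpowUniformlyConvex_of_finiteDimensional [StrictConvexSpace ℝ V]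
    [FiniteDimensional ℝ V] (hq : 1 < q) : NormRpowUniformlyConvex V q := by
  intro ε hε
  have hq0 : 0 < q := by linarith
  have : ProperSpace V := FiniteDimensional.proper ℝ V
  set N : V × V → ℝ := fun z => ‖z.1‖ ^ q + ‖z.2‖ ^ q with hN
  set δ : V × V → ℝ := fun z => N z / 2 - ‖(1 / 2 : ℝ) • (z.1 + z.2)‖ ^ q with hδ
  have hrp : Continuous fun t : ℝ => t ^ q := Real.continuous_rpow_const hq0.le
  have hNc : Continuous N := (hrp.comp continuous_fst.norm).add (hrp.comp continuous_snd.norm)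
  have hδc : Continuous δ := (hNc.div_const 2).sub
    (hrp.comp ((continuous_fst.add continuous_snd).const_smul (1 / 2 : ℝ)).norm)
  have hdc : Continuous fun z : V × V => ‖z.1 - z.2‖ ^ q :=
    hrp.comp (continuous_fst.sub continuous_snd).norm
  have hδ0 : ∀ z, 0 ≤ δ z := fun z => sub_nonneg.2 (norm_midpoint_rpow_le hq.le z.1 z.2)
  -- By homogeneity it suffices to treat pairs with `N = 1`. On the compact set of such pairs that
  -- are far apart the midpoint defect is positive, so its quotient with the distance is bounded.
  -- Close pairs are covered by the term with `ε`.
  set K : Set (V × V) := {z | N z = 1} ∩ {z | ε ≤ ‖z.1 - z.2‖ ^ q} with hK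
  have hKc : IsCompact K := by
    refine (isCompact_closedBall (0 : V × V) 1).of_isClosed_subset
      ((isClosed_eq hNc continuous_const).inter (isClosed_le continuous_const hdc)) ?_
    rintro z ⟨hz, -⟩
    have hz : ‖z.1‖ ^ q + ‖z.2‖ ^ q = 1 := hz
    have h1 : 0 ≤ ‖z.1‖ ^ q := by positivity
    have h2 : 0 ≤ ‖z.2‖ ^ q := by positivity
    have h3 : ∀ t : ℝ, 0 ≤ t → t ^ q ≤ 1 → t ≤ 1 := fun t ht h => by
      by_contra hcon
      exact absurd (Real.one_lt_rpow (not_le.1 hcon) hq0) (not_lt.2 h)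
    rw [mem_closedBall_zero_iff, Prod.norm_def]
    exact max_le (h3 _ (norm_nonneg _) (by linarith)) (h3 _ (norm_nonneg _) (by linarith))
  have hKpos : ∀ z ∈ K, 0 < δ z := fun z hz => by
    refine sub_pos.2 (norm_midpoint_rpow_lt hq fun h => ?_)
    have := hz.2
    rw [mem_ofPred_eq, h, sub_self, norm_zero, Real.zero_rpow hq0.ne'] at this
    linarith
  obtain ⟨C, hC⟩ := hKc.bddAbove_image (f := fun z => ‖z.1 - z.2‖ ^ q / δ z)
    (hdc.continuousOn.div hδc.continuousOn fun z hz => (hKpos z hz).ne')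
  have hsphere : ∀ z, N z = 1 → ‖z.1 - z.2‖ ^ q ≤ ε + max C 0 * δ z := fun z hz => by
    by_cases h : ε ≤ ‖z.1 - z.2‖ ^ q
    · have h1 : ‖z.1 - z.2‖ ^ q / δ z ≤ max C 0 := (hC ⟨z, ⟨hz, h⟩, rfl⟩).trans (le_max_left _ _)
      rw [div_le_iff₀ (hKpos z ⟨hz, h⟩)] at h1
      linarith
    · have := mul_nonneg (le_max_right C 0) (hδ0 z)
      linarith
  refine ⟨max C 0, le_max_right _ _, fun x y => ?_⟩
  set s := ‖x‖ ^ q + ‖y‖ ^ q with hs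
  have hx0 : 0 ≤ ‖x‖ ^ q := by positivity
  have hy0 : 0 ≤ ‖y‖ ^ q := by positivity
  rcases (by positivity : 0 ≤ s).eq_or_lt with h0 | hpos
  · have hx : x = 0 := by
      have : ‖x‖ ^ q = 0 := by linarith
      exact norm_eq_zero.1 ((Real.rpow_eq_zero (norm_nonneg _) hq0.ne').1 this)
    have hy : y = 0 := by
      have : ‖y‖ ^ q = 0 := by linarith
      exact norm_eq_zero.1 ((Real.rpow_eq_zero (norm_nonneg _) hq0.ne').1 this)
    rw [← h0, hx, hy]
    simp [Real.zero_rpow hq0.ne']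
  -- Scaling by `s ^ (-1/q)` moves the pair to the set `N = 1`.
  · set r := s ^ (-q⁻¹) with hr
    have hr0 : 0 ≤ r := by positivity
    have hrq : r ^ q = s⁻¹ := by
      rw [hr, ← Real.rpow_mul hpos.le, neg_mul, inv_mul_cancel₀ hq0.ne', Real.rpow_neg_one]
    have hscale : ∀ v : V, ‖r • v‖ ^ q = s⁻¹ * ‖v‖ ^ q := fun v => by
      rw [norm_smul, Real.norm_of_nonneg hr0, Real.mul_rpow hr0 (norm_nonneg _), hrq]
    have h1 := hsphere (r • x, r • y) (by
      simp only [hN]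
      rw [hscale, hscale, ← mul_add, ← hs, inv_mul_cancel₀ hpos.ne'])
    simp only [hδ, hN] at h1
    rw [← smul_sub, ← smul_add, smul_comm (1 / 2 : ℝ) r, hscale, hscale, hscale, hscale,
      ← mul_add, ← hs] at h1
    have h2 := mul_le_mul_of_nonneg_left h1 hpos.le
    have e1 : s * (s⁻¹ * ‖x - y‖ ^ q) = ‖x - y‖ ^ q := mul_inv_cancel_left₀ hpos.ne' _
    have e2 : s * (ε + max C 0 * (s⁻¹ * s / 2 - s⁻¹ * ‖(1 / 2 : ℝ) • (x + y)‖ ^ q)) =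
        ε * s + max C 0 * (s / 2 - ‖(1 / 2 : ℝ) • (x + y)‖ ^ q) := by
      field_simp
    rwa [e1, e2] at h2

/-- Uniform convexity of powers of the norm passes from `V` to `Lᵖ(V)`. -/
theorem NormRpowUniformlyConvex.lp {α : Type*} [MeasurableSpace α] {μ : Measure α} {p : ℝ≥0∞}
    [Fact (1 ≤ p)] (hp : p ≠ ⊤) (hV : NormRpowUniformlyConvex V p.toReal) :
    NormRpowUniformlyConvex (Lp V p μ) p.toReal := by
  have hp0 : p ≠ 0 := (zero_lt_one.trans_le Fact.out).ne'
  have hq0 : 0 < p.toReal := ENNReal.toReal_pos hp0 hp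
  have hnorm : ∀ g : Lp V p μ, ‖g‖ ^ p.toReal = ∫ t, ‖g t‖ ^ p.toReal ∂μ := fun g => by
    have h0 : 0 ≤ ∫ t, ‖g t‖ ^ p.toReal ∂μ := integral_nonneg fun t => by positivity
    rw [Lp.norm_def, (Lp.memLp g).eLpNorm_eq_integral_rpow_norm hp0 hp,
      ENNReal.toReal_ofReal (by positivity), ← Real.rpow_mul h0, inv_mul_cancel₀ hq0.ne',
      Real.rpow_one]
  have hint : ∀ g : Lp V p μ, Integrable (fun t => ‖g t‖ ^ p.toReal) μ := fun g =>
    (Lp.memLp g).integrable_norm_rpow hp0 hp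
  intro ε hε
  obtain ⟨C, hC, h⟩ := hV ε hε
  refine ⟨C, hC, fun x y => ?_⟩
  have i1 : Integrable (fun t => ‖x t‖ ^ p.toReal + ‖y t‖ ^ p.toReal) μ := (hint x).add (hint y)
  have i2 : Integrable (fun t => (‖x t‖ ^ p.toReal + ‖y t‖ ^ p.toReal) / 2) μ := i1.div_const 2
  have i3 := hint ((1 / 2 : ℝ) • (x + y))
  have i4 : Integrable (fun t => C * ((‖x t‖ ^ p.toReal + ‖y t‖ ^ p.toReal) / 2 -
    ‖((1 / 2 : ℝ) • (x + y)) t‖ ^ p.toReal)) μ := (i2.sub i3).const_mul C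
  have i5 : Integrable (fun t => ε * (‖x t‖ ^ p.toReal + ‖y t‖ ^ p.toReal)) μ := i1.const_mul ε
  rw [hnorm, hnorm, hnorm, hnorm, ← integral_add (hint x) (hint y), ← integral_div,
    ← integral_sub i2 i3, ← integral_const_mul, ← integral_const_mul, ← integral_add i5 i4]
  refine integral_mono_ae (hint _) (i5.add i4) ?_
  -- The inequality is linear in the `q`-th powers, so its pointwise form integrates directly.
  filter_upwards [Lp.coeFn_sub x y, Lp.coeFn_add x y, Lp.coeFn_smul (1 / 2 : ℝ) (x + y)]
    with t h1 h2 h3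
  rw [h1, h3, Pi.smul_apply, h2]
  exact h (x t) (y t)

/-- Weak compactness in a space embedded into a finite product of uniformly convex spaces. -/
theorem exists_forall_mem_closure_of_embedding {X ι : Type*} [NormedAddCommGroup X]
    [NormedSpace ℝ X] [CompleteSpace X] [Fintype ι] (hq : 1 ≤ q)
    (hV : NormRpowUniformlyConvex V q) (T : ι → X →L[ℝ] V) {A : ℝ}
    (hA : ∀ x, ‖x‖ ≤ A * ∑ i, ‖T i x‖) (C : ℕ → Set X)
    (hanti : Antitone C) (hconv : ∀ k, Convex ℝ (C k)) (hne : ∀ k, (C k).Nonempty)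
    (hbdd : Bornology.IsBounded (C 0)) : ∃ x, ∀ k, x ∈ closure (C k) := by
  have hq0 : 0 < q := by linarith
  obtain ⟨R, hR⟩ := hbdd.exists_norm_le
  have hnn : ∀ x, ∀ i, 0 ≤ ‖T i x‖ ^ q := fun x i => by positivity
  have hJ0 : ∀ x, 0 ≤ ∑ i, ‖T i x‖ ^ q := fun x => Finset.sum_nonneg fun i _ => hnn x i
  set B := ∑ i, (‖T i‖ * R) ^ q with hB
  have hJB : ∀ x ∈ C 0, ∑ i, ‖T i x‖ ^ q ≤ B := fun x hx =>
    Finset.sum_le_sum fun i _ => Real.rpow_le_rpow (norm_nonneg _)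
      ((T i).le_opNorm_of_le (hR x hx)) hq0.le
  have hB0 : 0 ≤ B := by
    obtain ⟨x, hx⟩ := hne 0
    exact (hJ0 x).trans (hJB x hx)
  refine exists_forall_mem_closure_of_uniformlyConvex (fun x => ∑ i, ‖T i x‖ ^ q) C hanti hconv
    hne hJB (fun x _ => hJ0 x) fun ε hε => ?_
  -- If every component of `x - y` has norm at most `η`, the embedding estimate `hA` gives `‖x - y‖
  -- ≤ ε`. To obtain `η`, the two terms of the uniform convexity estimate are each made at most `η ^
  -- q / 2`.
  set η := ε / ((|A| + 1) * (Fintype.card ι + 1)) with hη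
  have hη0 : 0 < η := by positivity
  have hηq : 0 < η ^ q := Real.rpow_pos_of_pos hη0 q
  obtain ⟨K, hK, huc⟩ := hV (η ^ q / (4 * (B + 1))) (by positivity)
  refine ⟨η ^ q / (2 * (K + 1)), by positivity, fun x hx y hy hdef => ?_⟩
  set d : ι → ℝ := fun i => (‖T i x‖ ^ q + ‖T i y‖ ^ q) / 2 - ‖(1 / 2 : ℝ) • (T i x + T i y)‖ ^ q
  have hd0 : ∀ i, 0 ≤ d i := fun i => sub_nonneg.2 (norm_midpoint_rpow_le hq _ _)
  have hdsum : ∑ i, d i ≤ η ^ q / (2 * (K + 1)) := by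
    refine le_trans (le_of_eq ?_) hdef
    simp only [d, map_smul, map_add]
    rw [Finset.sum_sub_distrib, ← Finset.sum_div, Finset.sum_add_distrib]
  have hcomp : ∀ i, ‖T i (x - y)‖ ≤ η := fun i => by
    have h1 := huc (T i x) (T i y)
    have h2 : d i ≤ η ^ q / (2 * (K + 1)) :=
      (Finset.single_le_sum (fun j _ => hd0 j) (Finset.mem_univ i)).trans hdsum
    have h3 : ‖T i x‖ ^ q ≤ B :=
      (Finset.single_le_sum (fun j _ => hnn x j) (Finset.mem_univ i)).trans (hJB x hx)
    have h4 : ‖T i y‖ ^ q ≤ B :=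
      (Finset.single_le_sum (fun j _ => hnn y j) (Finset.mem_univ i)).trans (hJB y hy)
    have h5 : η ^ q / (4 * (B + 1)) * (‖T i x‖ ^ q + ‖T i y‖ ^ q) ≤ η ^ q / 2 := by
      calc _ ≤ η ^ q / (4 * (B + 1)) * (2 * (B + 1)) := by
            refine mul_le_mul_of_nonneg_left (by linarith) (by positivity)
        _ = η ^ q / 2 := by field_simp; ring
    have h6 : K * d i ≤ η ^ q / 2 := by
      calc K * d i ≤ (K + 1) * (η ^ q / (2 * (K + 1))) :=
            mul_le_mul (by linarith) h2 (hd0 i) (by positivity)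
        _ = η ^ q / 2 := by field_simp
    simp only [d] at h6
    rw [map_sub]
    refine (Real.rpow_le_rpow_iff (norm_nonneg _) hη0.le hq0).1 ?_
    linarith
  rw [dist_eq_norm]
  have hsum : ∑ i, ‖T i (x - y)‖ ≤ Fintype.card ι * η := by
    refine (Finset.sum_le_sum fun i _ => hcomp i).trans ?_
    simp
  have hsum0 : 0 ≤ ∑ i, ‖T i (x - y)‖ := Finset.sum_nonneg fun i _ => norm_nonneg _
  calc ‖x - y‖ ≤ A * ∑ i, ‖T i (x - y)‖ := hA _
    _ ≤ (|A| + 1) * ((Fintype.card ι + 1) * η) := by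
        refine mul_le_mul ((le_abs_self A).trans (by linarith)) ?_ hsum0 (by positivity)
        exact hsum.trans (mul_le_mul_of_nonneg_right (by linarith) hη0.le)
    _ = ε := by
        rw [hη]
        field_simp

end UniformConvexity

/-! ### Completeness and weak compactness of the Sobolev space -/

section SobolevCompactness

variable {n : ℕ} {Ω : Set (RR n)} {N : ℕ} {p : ℝ≥0∞} [Fact (1 ≤ p)]

/-- A continuous compactly supported weight lies in the conjugate Lebesgue space, so this is a
Hölder pairing. -/
theorem continuous_integral_smul_lp {E : Type*} [NormedAddCommGroup E] [NormedSpace ℝ E]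
    [CompleteSpace E] {μ : Measure (RR n)} [IsFiniteMeasureOnCompacts μ] {ψ : RR n → ℝ}
    (hψ : Continuous ψ) (hψc : HasCompactSupport ψ) :
    Continuous fun g : Lp E p μ => ∫ x, ψ x • g x ∂μ := by
  have hmem : MemLp ψ p.conjExponent μ := hψ.memLp_of_hasCompactSupport hψc
  have : Fact (1 ≤ p.conjExponent) := ⟨(inferInstance : p.conjExponent.HolderConjugate p).one_le⟩
  refine (((ContinuousLinearMap.lsmul ℝ ℝ : ℝ →L[ℝ] E →L[ℝ] E).lpPairing μ p.conjExponent p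
    (hmem.toLp ψ)).continuous).congr fun g => ?_
  rw [ContinuousLinearMap.lpPairing_eq_integral]
  refine integral_congr_ae ?_
  filter_upwards [hmem.coeFn_toLp] with x hx
  rw [hx, ContinuousLinearMap.lsmul_apply]

theorem isClosed_W1p : IsClosed (W1p Ω N p : Set (LpVec Ω N p × LpMat Ω N p)) := by
  have : (W1p Ω N p : Set (LpVec Ω N p × LpMat Ω N p)) =
      ⋂ (φ : RR n → ℝ) (_ : IsTest Ω φ) (e : RR n), {w | ∫ x in Ω, (fderiv ℝ φ x e) • w.1 x =
        - ∫ x in Ω, φ x • w.2 x e} := by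
    ext w
    simp only [mem_iInter]
    rfl
  rw [this]
  refine isClosed_iInter fun φ => isClosed_iInter fun hφ => isClosed_iInter fun e => ?_
  have hd : Continuous fun x => fderiv ℝ φ x e :=
    (hφ.1.continuous_fderiv (by simp)).clm_apply continuous_const
  have hdc : HasCompactSupport fun x => fderiv ℝ φ x e := hφ.2.1.fderiv_apply (𝕜 := ℝ) e
  refine isClosed_eq ((continuous_integral_smul_lp hd hdc).comp continuous_fst) ?_
  have h1 : Continuous fun g : LpMat Ω N p => ∫ x in Ω, φ x • g x e := by
    refine ((continuous_integral_smul_lp (p := p) (μ := volume.restrict Ω) hφ.1.continuous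
      hφ.2.1).comp ((ContinuousLinearMap.apply ℝ (RR N) e).compLpL p
        (volume.restrict Ω)).continuous).congr fun g => ?_
    refine integral_congr_ae ?_
    filter_upwards [(ContinuousLinearMap.apply ℝ (RR N) e).coeFn_compLpL g] with x hx
    rw [hx, ContinuousLinearMap.apply_apply]
  exact (h1.comp continuous_snd).neg

instance : CompleteSpace (W0p Ω N p) := by
  have : CompleteSpace (W1p Ω N p) := isClosed_W1p.completeSpace_coe
  exact (testSubmodule Ω N p).isClosed_topologicalClosure.completeSpace_coe

/-- The inclusion of `W_0^{1,p}` into `Lᵖ × Lᵖ`. -/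
noncomputable def W0p.toProd : W0p Ω N p →L[ℝ] LpVec Ω N p × LpMat Ω N p :=
  (W1p Ω N p).subtypeL.comp (testSubmodule Ω N p).topologicalClosure.subtypeL

theorem W0p.norm_toProd (w : W0p Ω N p) : ‖W0p.toProd w‖ = ‖w‖ := rfl

/-- The function and its partial derivatives. -/
noncomputable def W0p.component : Option (Fin n) → W0p Ω N p →L[ℝ] LpVec Ω N p
  | none => (ContinuousLinearMap.fst ℝ _ _).comp W0p.toProd
  | some i => ((ContinuousLinearMap.apply ℝ (RR N) (EuclideanSpace.basisFun (Fin n) ℝ i)).compLpL p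
      (volume.restrict Ω)).comp ((ContinuousLinearMap.snd ℝ _ _).comp W0p.toProd)

/-- The operator norm on matrices is not strictly convex in general, so uniform convexity is applied
to the columns of `Du`, which take values in the Euclidean space `ℝᴺ`. Reassembling `Du` from its
columns costs only a constant. -/
theorem W0p.exists_norm_le :
    ∃ A : ℝ, ∀ w : W0p Ω N p, ‖w‖ ≤ A * ∑ i, ‖W0p.component i w‖ := by
  let Ψ : Fin n → RR N →L[ℝ] (RR n →L[ℝ] RR N) := fun i =>
    ContinuousLinearMap.smulRightL ℝ (RR n) (RR N) (EuclideanSpace.proj i)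
  let P : Fin n → LpVec Ω N p →L[ℝ] LpMat Ω N p := fun i => (Ψ i).compLpL p (volume.restrict Ω)
  refine ⟨1 + ∑ i, ‖P i‖, fun w => ?_⟩
  set S := ∑ i, ‖W0p.component i w‖ with hS
  have hle : ∀ i, ‖W0p.component i w‖ ≤ S := fun i =>
    Finset.single_le_sum (f := fun i => ‖W0p.component i w‖) (fun j _ => norm_nonneg _)
      (Finset.mem_univ i)
  have hS0 : 0 ≤ S := (norm_nonneg _).trans (hle none)
  have hP0 : 0 ≤ ∑ i, ‖P i‖ := by positivity
  have hrec : (W0p.toProd w).2 = ∑ i, P i (W0p.component (some i) w) := by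
    refine Lp.ext ?_
    have h1 : ∀ᵐ x ∂(volume.restrict Ω), ∀ i, P i (W0p.component (some i) w) x =
        Ψ i ((W0p.toProd w).2 x (EuclideanSpace.basisFun (Fin n) ℝ i)) := ae_all_iff.2 fun i => by
      filter_upwards [(Ψ i).coeFn_compLpL (W0p.component (some i) w),
        (ContinuousLinearMap.apply ℝ (RR N) (EuclideanSpace.basisFun (Fin n) ℝ i)).coeFn_compLpL
          (W0p.toProd w).2] with x hx1 hx2
      rw [hx1]
      exact congrArg (Ψ i) hx2
    filter_upwards [h1, Lp.coeFn_finsetSum Finset.univ fun i => P i (W0p.component (some i) w)]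
      with x h1 h2
    rw [h2, Finset.sum_apply]
    simp only [h1]
    refine ContinuousLinearMap.coe_injective ?_
    refine (EuclideanSpace.basisFun (Fin n) ℝ).toBasis.ext fun j => ?_
    simp [Ψ, Finset.sum_apply]
  rw [← W0p.norm_toProd, Prod.norm_def]
  refine max_le ?_ ?_
  · calc ‖(W0p.toProd w).1‖ = ‖W0p.component none w‖ := rfl
      _ ≤ 1 * S := by rw [one_mul]; exact hle none
      _ ≤ _ := mul_le_mul_of_nonneg_right (by linarith) hS0
  · calc ‖(W0p.toProd w).2‖ ≤ ∑ i, ‖P i‖ * S := by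
          rw [hrec]
          refine norm_sum_le_of_le _ fun i _ => ?_
          exact (P i).le_opNorm_of_le (hle (some i))
      _ = (∑ i, ‖P i‖) * S := by rw [Finset.sum_mul]
      _ ≤ _ := mul_le_mul_of_nonneg_right (by linarith) hS0

/-- Weak compactness in `W_0^{1,p}`, `1 < p < ∞`. -/
theorem W0p.exists_forall_mem_closure (hp1 : 1 < p) (hp2 : p < ⊤) (C : ℕ → Set (W0p Ω N p))
    (hanti : Antitone C) (hconv : ∀ k, Convex ℝ (C k)) (hne : ∀ k, (C k).Nonempty)
    (hbdd : Bornology.IsBounded (C 0)) : ∃ x, ∀ k, x ∈ closure (C k) := by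
  have hq : 1 < p.toReal := by
    rw [← ENNReal.toReal_one]
    exact (ENNReal.toReal_lt_toReal ENNReal.one_ne_top hp2.ne).2 hp1
  obtain ⟨A, hA⟩ := W0p.exists_norm_le (Ω := Ω) (N := N) (p := p)
  exact exists_forall_mem_closure_of_embedding hq.le
    ((normRpowUniformlyConvex_of_finiteDimensional hq).lp hp2.ne) W0p.component hA C hanti hconv
    hne hbdd

end SobolevCompactness

/-! ### From the functional on the Sobolev space to a closed convex functional on `L²` -/

section EnergyFunctional

variable {n : ℕ} {Ω : Set (RR n)} {N : ℕ} {p : ℝ≥0∞} [Fact (1 ≤ p)] {F : W0p Ω N p → EReal}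

theorem Represents.add_smul {v w : W0p Ω N p} {x y : LpVec Ω N 2} (hv : Represents v x)
    (hw : Represents w y) (a b : ℝ) : Represents (a • v + b • w) (a • x + b • y) := by
  have h0 : W0p.toLp (a • v + b • w) = a • W0p.toLp v + b • W0p.toLp w := rfl
  unfold Represents at *
  rw [h0]
  filter_upwards [Lp.coeFn_add (a • W0p.toLp v) (b • W0p.toLp w), Lp.coeFn_smul a (W0p.toLp v),
    Lp.coeFn_smul b (W0p.toLp w), Lp.coeFn_add (a • x) (b • y), Lp.coeFn_smul a x,
    Lp.coeFn_smul b y, hv, hw] with t h1 h2 h3 h4 h5 h6 h7 h8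
  rw [h1, h4, Pi.add_apply, Pi.add_apply, h2, h3, h5, h6, Pi.smul_apply, Pi.smul_apply,
    Pi.smul_apply, Pi.smul_apply, h7, h8]

theorem Represents.memLp {v : W0p Ω N p} {x : LpVec Ω N 2} (hv : Represents v x) :
    MemLp (W0p.toLp v) 2 (volume.restrict Ω) :=
  (memLp_congr_ae hv).2 (Lp.memLp x)

/-- Convergence in `Lᵖ` and in `L²` both imply convergence in measure, whose limit is unique almost
everywhere. -/
theorem represents_of_tendsto {v : ℕ → W0p Ω N p} {x : ℕ → LpVec Ω N 2} {w : W0p Ω N p}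
    {y : LpVec Ω N 2} (h : ∀ k, Represents (v k) (x k)) (hv : Tendsto v atTop (𝓝 w))
    (hx : Tendsto x atTop (𝓝 y)) : Represents w y := by
  have h1 : Tendsto (fun k => W0p.toLp (v k)) atTop (𝓝 (W0p.toLp w)) :=
    ((continuous_fst.comp W0p.toProd.continuous).tendsto w).comp hv
  have h2 := tendstoInMeasure_of_tendsto_Lp h1
  have h3 := tendstoInMeasure_of_tendsto_Lp hx
  exact tendstoInMeasure_ae_unique h2 (h3.congr (fun k => (h k).symm) Filter.EventuallyEq.rfl)

/-- The elements of a sublevel set of `F` whose function lies in `B`. -/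
def sublevelOver (F : W0p Ω N p → EReal) (B : Set (LpVec Ω N 2)) (c : ℝ) : Set (W0p Ω N p) :=
  {w | ∃ v ∈ B, Represents w v ∧ F w ≤ c}

theorem convex_sublevelOver (hconv : ConvexOnL2 F) {B : Set (LpVec Ω N 2)} (hB : Convex ℝ B)
    (c : ℝ) : Convex ℝ (sublevelOver F B c) := by
  rintro v ⟨x, hx, hvx, hv⟩ w ⟨y, hy, hwy, hw⟩ a b ha hb hab
  refine ⟨a • x + b • y, hB hx hy ha hb hab, hvx.add_smul hwy a b, ?_⟩
  refine (hconv v w hvx.memLp hwy.memLp a b ha hb hab).trans ?_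
  have h1 : (a : EReal) * F v ≤ (a : EReal) * c :=
    mul_le_mul_of_nonneg_left hv (EReal.coe_nonneg.2 ha)
  have h2 : (b : EReal) * F w ≤ (b : EReal) * c :=
    mul_le_mul_of_nonneg_left hw (EReal.coe_nonneg.2 hb)
  refine (add_le_add h1 h2).trans (le_of_eq ?_)
  rw [← EReal.coe_mul, ← EReal.coe_mul, ← EReal.coe_add, ← add_mul, hab, one_mul]

theorem isBounded_sublevelOver (hcoer : Coercive F) (B : Set (LpVec Ω N 2)) (c : ℝ) :
    Bornology.IsBounded (sublevelOver F B c) := by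
  have h1 : ∀ᶠ w in Bornology.cobounded (W0p Ω N p), (c : EReal) < F w :=
    hcoer.eventually (lt_mem_nhds (EReal.coe_lt_top c))
  rw [Bornology.isBounded_def]
  filter_upwards [h1] with w hw
  rintro ⟨-, -, -, h⟩
  exact absurd hw (not_lt.2 h)

/-- The energy as a real-valued function on its domain. -/
noncomputable def realEnergy (F : W0p Ω N p → EReal) (u : LpVec Ω N 2) : ℝ := (energy F u).toReal

theorem exists_represents_of_mem_dom (hΩ : IsOpen Ω) (hbot : ∀ w, F w ≠ ⊥) {u : LpVec Ω N 2}
    (hu : u ∈ dom F) : ∃ w, Represents w u ∧ F w = realEnergy F u := by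
  obtain ⟨⟨w, hw⟩, hfin⟩ := hu
  have h1 := energy_eq hΩ F hw
  refine ⟨w, hw, ?_⟩
  rw [realEnergy, h1, EReal.coe_toReal (by rw [← h1]; exact hfin.ne) (hbot w)]

theorem coe_realEnergy (hΩ : IsOpen Ω) (hbot : ∀ w, F w ≠ ⊥) {u : LpVec Ω N 2}
    (hu : u ∈ dom F) : (realEnergy F u : EReal) = energy F u := by
  obtain ⟨w, hw, h⟩ := exists_represents_of_mem_dom hΩ hbot hu
  rw [← h, energy_eq hΩ F hw]

theorem mem_dom_of_represents (hΩ : IsOpen Ω) (hbot : ∀ w, F w ≠ ⊥) {u : LpVec Ω N 2}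
    {w : W0p Ω N p} (hw : Represents w u) {c : ℝ} (hc : F w ≤ c) :
    u ∈ dom F ∧ realEnergy F u ≤ c := by
  have h1 := energy_eq hΩ F hw
  have hu : u ∈ dom F := ⟨⟨w, hw⟩, by rw [h1]; exact hc.trans_lt (EReal.coe_lt_top c)⟩
  refine ⟨hu, ?_⟩
  rw [← EReal.coe_le_coe_iff, coe_realEnergy hΩ hbot hu, h1]
  exact hc

theorem represents_zero : Represents (0 : W0p Ω N p) 0 := by
  have h0 : W0p.toLp (0 : W0p Ω N p) = 0 := rfl
  unfold Represents
  rw [h0]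
  filter_upwards [Lp.coeFn_zero (RR N) p (volume.restrict Ω),
    Lp.coeFn_zero (RR N) 2 (volume.restrict Ω)] with x h1 h2
  rw [h1, h2]

/-- The energy is a closed convex functional on `L²`. -/
theorem convexEnergy (hΩ : IsOpen Ω) (hp1 : 1 < p) (hp2 : p < ⊤) (hbot : ∀ w, F w ≠ ⊥)
    (hzero : F 0 < ⊤) (hcoer : Coercive F) (hlsc : LowerSemicontinuous F) (hconv : ConvexOnL2 F) :
    ConvexEnergy (dom F) (realEnergy F) := by
  have hcomb : ∀ x ∈ dom F, ∀ y ∈ dom F, ∀ a b : ℝ, 0 ≤ a → 0 ≤ b → a + b = 1 →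
      a • x + b • y ∈ dom F ∧
        realEnergy F (a • x + b • y) ≤ a * realEnergy F x + b * realEnergy F y := by
    intro x hx y hy a b ha hb hab
    obtain ⟨v, hv, hFv⟩ := exists_represents_of_mem_dom hΩ hbot hx
    obtain ⟨w, hw, hFw⟩ := exists_represents_of_mem_dom hΩ hbot hy
    refine mem_dom_of_represents hΩ hbot (hv.add_smul hw a b) ?_
    refine (hconv v w hv.memLp hw.memLp a b ha hb hab).trans (le_of_eq ?_)
    rw [hFv, hFw, EReal.coe_add, EReal.coe_mul, EReal.coe_mul]
  refine ⟨⟨fun x hx y hy a b ha hb hab => (hcomb x hx y hy a b ha hb hab).1,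
    fun x hx y hy a b ha hb hab => (hcomb x hx y hy a b ha hb hab).2⟩,
    ⟨0, (mem_dom_of_represents hΩ hbot represents_zero
      (EReal.coe_toReal hzero.ne (hbot 0)).ge).1⟩, ?_, fun c => ?_⟩
  -- Were the energy unbounded below, the sublevel sets at heights `-k` would have a common point of
  -- closure, where `F` would equal `⊥`. That point need not be in `L²`, but `F` avoids `⊥` on all
  -- of `W_0^{1,p}`.
  · by_contra hcon
    push Not at hcon
    obtain ⟨x, hx⟩ := W0p.exists_forall_mem_closure hp1 hp2
      (fun k : ℕ => sublevelOver F univ (-(k : ℝ)))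
      (fun k l hkl => by
        rintro w ⟨v, hv, hwv, h⟩
        refine ⟨v, hv, hwv, h.trans (EReal.coe_le_coe_iff.2 (neg_le_neg ?_))⟩
        exact_mod_cast hkl)
      (fun k => convex_sublevelOver hconv convex_univ _) (fun k => by
        obtain ⟨u, hu, hlt⟩ := hcon (-(k : ℝ))
        obtain ⟨w, hw, hFw⟩ := exists_represents_of_mem_dom hΩ hbot hu
        exact ⟨w, u, mem_univ u, hw, by rw [hFw]; exact EReal.coe_le_coe_iff.2 hlt.le⟩)
      (isBounded_sublevelOver hcoer _ _)
    refine hbot x (EReal.eq_bot_iff_forall_lt _ |>.2 fun r => ?_)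
    obtain ⟨k, hk⟩ := exists_nat_gt (-r)
    have h1 : F x ≤ (-(k : ℝ) : ℝ) :=
      closure_minimal (t := F ⁻¹' Iic ((-(k : ℝ) : ℝ) : EReal)) (by
        rintro w ⟨v, -, -, h⟩
        exact h) (hlsc.isClosed_preimage _) (hx k)
    exact h1.trans_lt (EReal.coe_lt_coe_iff.2 (by linarith))
  · refine isSeqClosed_iff_isClosed.1 fun u y hu huy => ?_
    -- Restricting the sublevel set to functions in shrinking `L²` balls around `y` forces the
    -- common point of closure to represent `y`. Lower semicontinuity gives it energy at most `c`.
    obtain ⟨x, hx⟩ := W0p.exists_forall_mem_closure hp1 hp2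
      (fun k : ℕ => sublevelOver F (Metric.closedBall y (1 / ((k : ℝ) + 1))) c)
      (fun k l hkl => by
        rintro w ⟨v, hv, hwv, h⟩
        have : (k : ℝ) ≤ l := by exact_mod_cast hkl
        exact ⟨v, Metric.closedBall_subset_closedBall (by gcongr) hv, hwv, h⟩)
      (fun k => convex_sublevelOver hconv (convex_closedBall _ _) _) (fun k => by
        obtain ⟨j, hj⟩ := (huy.eventually (Metric.closedBall_mem_nhds y
          (by positivity : (0 : ℝ) < 1 / ((k : ℝ) + 1)))).exists
        obtain ⟨w, hw, hFw⟩ := exists_represents_of_mem_dom hΩ hbot (hu j).1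
        exact ⟨w, u j, hj, hw, by rw [hFw]; exact EReal.coe_le_coe_iff.2 (hu j).2⟩)
      (isBounded_sublevelOver hcoer _ _)
    have hex : ∀ k : ℕ, ∃ w v, Represents w v ∧ dist v y ≤ 1 / ((k : ℝ) + 1) ∧
        dist w x ≤ 1 / ((k : ℝ) + 1) := fun k => by
      obtain ⟨w, ⟨v, hv, hwv, -⟩, hd⟩ := Metric.mem_closure_iff.1 (hx k) (1 / ((k : ℝ) + 1))
        (by positivity)
      rw [dist_comm] at hd
      exact ⟨w, v, hwv, hv, hd.le⟩
    choose w v hwv hv hw using hex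
    have hrep : Represents x y := represents_of_tendsto hwv
      (tendsto_iff_dist_tendsto_zero.2 (squeeze_zero (fun _ => dist_nonneg) hw
        tendsto_one_div_add_atTop_nhds_zero_nat))
      (tendsto_iff_dist_tendsto_zero.2 (squeeze_zero (fun _ => dist_nonneg) hv
        tendsto_one_div_add_atTop_nhds_zero_nat))
    refine mem_dom_of_represents hΩ hbot hrep ?_
    exact closure_minimal (t := F ⁻¹' Iic (c : EReal)) (by
      rintro w ⟨v, -, -, h⟩
      exact h) (hlsc.isClosed_preimage _) (hx 0)

theorem subdiff_eq_subgrad (hΩ : IsOpen Ω) (hbot : ∀ w, F w ≠ ⊥) (u : LpVec Ω N 2) :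
    subdiff F u = subgrad (dom F) (realEnergy F) u := by
  ext v
  refine and_congr_right fun hu => forall₂_congr fun w hw => ?_
  rw [← coe_realEnergy hΩ hbot hu, ← coe_realEnergy hΩ hbot hw, ← EReal.coe_add,
    EReal.coe_le_coe_iff]

theorem isMinimalSection_iff (hΩ : IsOpen Ω) (hbot : ∀ w, F w ≠ ⊥) (u a : LpVec Ω N 2) :
    IsMinimalSection F u a ↔ IsMinSubgrad (dom F) (realEnergy F) u a := by
  rw [IsMinimalSection, IsMinSubgrad, subdiff_eq_subgrad hΩ hbot]

theorem minimalSection_eq {u a : LpVec Ω N 2} (h : IsMinimalSection F u a) :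
    minimalSection F u = a := by
  have hex : ∃ a, IsMinimalSection F u a := ⟨a, h⟩
  rw [minimalSection, dif_pos hex]
  by_contra hne
  exact lt_asymm (h.2 _ hex.choose_spec.1 hne) (hex.choose_spec.2 a h.1 (Ne.symm hne))

end EnergyFunctional

end GradFlow

/-! ### The theorem, assembled from the abstract flow -/

theorem theorem1p1 {n N : ℕ} (hn : 1 ≤ n) (hN : 1 ≤ N)
    (Ω : Set (GradFlow.RR n)) (hΩo : IsOpen Ω) (hΩc : IsConnected Ω)
    (hΩb : Bornology.IsBounded Ω)
    (p : ℝ≥0∞) [Fact (1 ≤ p)] (hp1 : 1 < p) (hp2 : p < ⊤)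
    (F : GradFlow.W0p Ω N p → EReal) (hbot : ∀ w, F w ≠ ⊥) (hzero : F 0 < ⊤)
    (hcoer : GradFlow.Coercive F) (hlsc : LowerSemicontinuous F)
    (hconv : GradFlow.ConvexOnL2 F) :
    -- the minimal section `A⁰` is well defined on the domain of the subdifferential
    (∀ w ∈ GradFlow.subdiffDom F,
      IsClosed (GradFlow.subdiff F w) ∧ Convex ℝ (GradFlow.subdiff F w) ∧
      GradFlow.IsMinimalSection F w (GradFlow.minimalSection F w)) ∧
    ∀ u₀ ∈ closure (GradFlow.dom F),
      ∃ u du : ℝ → GradFlow.LpVec Ω N 2,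
        -- existence and uniqueness
        GradFlow.IsFlow F u₀ u du ∧
        (∀ v dv : ℝ → GradFlow.LpVec Ω N 2, GradFlow.IsFlow F u₀ v dv → EqOn v u (Ici 0)) ∧
        -- the energy is locally integrable up to time zero
        (∀ T : ℝ, 0 < T →
          IntegrableOn (fun t => (GradFlow.energy F (u t)).toReal) (Ioo 0 T)) ∧
        -- the energy is nonincreasing
        AntitoneOn (fun t => (GradFlow.energy F (u t)).toReal) (Ioi 0) ∧
        -- the velocity bound
        (∀ δ : ℝ, 0 < δ →
          eLpNorm du ⊤ (volume.restrict (Ioi δ)) ≤ ‖GradFlow.minimalSection F (u δ)‖ₑ) ∧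
        -- the velocity is the minimal section
        (∀ᵐ t ∂(volume.restrict (Ioi (0 : ℝ))), - du t = GradFlow.minimalSection F (u t)) ∧
        -- initial data of finite energy
        (u₀ ∈ GradFlow.dom F → ∀ T : ℝ, 0 < T →
          MemLp du 2 (volume.restrict (Ioo 0 T)) ∧
          GradFlow.MemW11 T (fun t => (GradFlow.energy F (u t)).toReal)) ∧
        -- initial data in the domain of the subdifferential
        (u₀ ∈ GradFlow.subdiffDom F → MemLp du ⊤ (volume.restrict (Ioi 0))) := by
  have hf := GradFlow.convexEnergy hΩo hp1 hp2 hbot hzero hcoer hlsc hconv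
  have hsub := GradFlow.subdiff_eq_subgrad (F := F) hΩo hbot
  have hmin := GradFlow.isMinimalSection_iff (F := F) hΩo hbot
  refine ⟨fun w hw => ⟨?_, ?_, ?_⟩, fun u₀ hu₀ => ?_⟩
  · rw [hsub]
    exact GradFlow.isClosed_subgrad w
  · rw [hsub]
    exact GradFlow.convex_subgrad w
  · have hne := hw.2
    rw [hsub] at hne
    obtain ⟨z, hz⟩ := GradFlow.exists_minimal_subgrad hne
    rw [← hmin] at hz
    rwa [GradFlow.minimalSection_eq hz]
  obtain ⟨u, hu, rfl⟩ := hf.exists_isEVI hu₀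
  -- This holds at every positive time, which the bound by `A⁰(u(δ))` at each `δ` requires.
  have hA : ∀ t, 0 < t → GradFlow.minimalSection F (u t) = -GradFlow.rightDeriv u t := fun t ht =>
    GradFlow.minimalSection_eq ((hmin _ _).2 (hf.isMinSubgrad_neg_rightDeriv hu ht))
  have hflow : GradFlow.IsFlow F (u 0) u (GradFlow.rightDeriv u) :=
    { continuousOn := hu.continuousOn
      weakDeriv := hf.hasWeakDerivOn hu
      bound := fun δ hδ => hf.memLp_top_rightDeriv hu hδ.le (hf.subgrad_nonempty hu hδ)
      mem_dom := fun t ht => ⟨hu.mem t ht, by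
        rw [hsub]
        exact hf.subgrad_nonempty hu ht⟩
      inclusion := by
        filter_upwards [ae_restrict_mem measurableSet_Ioi] with t ht
        rw [hsub]
        exact (hf.isMinSubgrad_neg_rightDeriv hu ht).1
      initial := rfl }
  refine ⟨u, GradFlow.rightDeriv u, hflow, fun v dv hv t ht => ?_,
    fun T hT => hf.integrableOn_energy hu hT, hu.antitoneOn, fun δ hδ => ?_, ?_,
    fun h0 T hT => ⟨hf.memLp_two_rightDeriv hu h0 hT, hf.memW11_energy hu h0 hT⟩, fun h0 => ?_⟩
  -- A competitor `v` satisfies the inclusion only almost everywhere and is not known to solve the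
  -- evolution inequality, so the comparison is made between weak derivatives.
  · have h1 := hv.inclusion
    have h2 := hflow.inclusion
    simp only [hsub] at h1 h2
    have := GradFlow.norm_sub_le_of_hasWeakDerivOn hv.continuousOn hu.continuousOn hv.weakDeriv
      hflow.weakDeriv hv.bound hflow.bound h1 h2 ht
    rw [hv.initial, sub_self, norm_zero] at this
    exact sub_eq_zero.1 (norm_le_zero_iff.1 this)
  · rw [hA δ hδ]
    exact hf.eLpNorm_rightDeriv_le hu hδ.le (hf.isMinSubgrad_neg_rightDeriv hu hδ).1
  · filter_upwards [ae_restrict_mem measurableSet_Ioi] with t ht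
    rw [hA t ht]
  · have h1 := h0.2
    rw [hsub] at h1
    exact hf.memLp_top_rightDeriv hu le_rfl h1
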